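/- Let $p\ge 3$ be a prime, fix embeddings of $\bar{\mathbb Q}$ into $\mathbb C$ and into $\bar{\mathbb Q}_p\subset\mathbb C_p$, let $L\subset\bar{\mathbb Q}_p$ be a finite extension of $\mathbb Q_p$ with ring of integers $\mathcal O_L$, and let $\Lambda=\mathcal O_L[[1+p\mathbb Z_p]]=\mathcal O_L[[T]]$ (with $[1+p]\leftrightarrow 1+T$). Let $\omega$ be the Teichmüller character modulo $p$. Let $(R,\varphi)$ be a complete noetherian local domain with maximal ideal $\mathfrak m$, with a local homomorphism $\varphi:\Lambda\to R$ that is flat, and with the same residue field as $\mathcal O_L$. An *$R$-weight* is an $\mathfrak m$-adically continuous $\mathcal O_L$-algebra homomorphism $w:R\to\mathbb C_p$. It is *arithmetic*, $w=(k,\varepsilon)$, if $w(\varphi(T))=\varepsilon(1+p)(1+p)^k-1$ with $k\ge 1$ an integer and $\varepsilon$ a finite order character of $1+p\mathbb Z_p$ (viewed as a character of $\mathbb Z_p^\times$ through $a\mapsto a\,\omega(a)^{-1}$); it is *integral classical* of weight $k_w=k$ if moreover $\varepsilon=1$ and $k\ge 2$. A set $\Omega$ of integral classical $R$-weights is *admissible*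 if the closure of $\{k_w: w\in\Omega\}$ in $\mathbb Z_p$ contains a non-empty open set and $\bigcap_{w\in\Omega}\ker w=0$. For $\xi\in R[[q]]$ write $\xi_w\in\mathbb C_p[[q]]$ for the series obtained by applying $w$ to the coefficients. Write $M_k(M,\psi,\mathbb C_p)$ (resp. $S_k$) for the $\mathbb C_p$-span in $\mathbb C_p[[q]]$ of the $q$-expansions of classical modular forms (resp. cusp forms) of weight $k$, level $\Gamma_1(M)$, nebentypus $\psi$ and with algebraic Fourier coefficients. Let $N\ge 1$ with $p\nmid N$, let $t\ge 1$, let $\chi$ be a Dirichlet character modulo $Np^t$ with values in $\mathcal O_L^\times$ and let $\Omega$ be an admissible set. Let $\mathbb M=\mathbb M_\Omega$ (resp. $\mathbb S_\Omega$) be the $R$-submodule of all $\xi\in R[[q]]$ such that $\xi_w\in M_{k_w}(Np^t,\chi\omega^{2-k_w},\mathbb C_p)$ (resp. $S_{k_w}(Np^t,\chi\omega^{2-k_w},\mathbb C_p)$) for all $w\in\Omega$, with the topology induced by the $\mathfrak m$-adic topology of $R[[q]]$, i.e. with the subgroups $\mathbb M\cap\mathfrak m^jR[[q]]$ as a basis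 of neighbourhoods of $0$. On $R[[q]]$ let $U_p(\sum a_nq^n)=\sum a_{np}q^n$, and for primes $\ell\nmid Np$ let $$a_n(T_\ell\xi)=a_{n\ell}(\xi)+\langle\ell\rangle\chi(\ell)\omega(\ell)^2\ell^{-1}a_{n/\ell}(\xi),$$ where the last term is omitted if $\ell\nmid n$, and $\langle\ell\rangle\in R$ is the image of $[\ell\,\omega(\ell)^{-1}]\in\Lambda$. **Proposition.** $U_p$ and the $T_\ell$ ($\ell\nmid Np$ prime) map $\mathbb M$ into itself. There is a unique $e=e^{\mathrm{ord}}\in\mathrm{End}_R(\mathbb M)$ satisfying (i); it is idempotent, and it also satisfies (ii)–(iv): (i) $e(\xi)=\lim_{n\to\infty}U_p^{n!}(\xi)$ for all $\xi\in\mathbb M$. (ii) $e$ commutes with $U_p$, and $\mathbb M=e\mathbb M\oplus(1-e)\mathbb M$ is a $U_p$-stable decomposition such that $U_p$ is bijective on $e\mathbb M$ and topologically nilpotent on $(1-e)\mathbb M$ (for every $j$ there is $n_0$ with $U_p^n((1-e)\mathbb M)\subseteq\mathfrak m^jR[[q]]$ for all $n\ge n_0$). (iii) $e$ commutes with $T_\ell$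 for every prime $\ell\nmid Np$. It is compatible with arithmetic specializations: if $\xi\in\mathbb M$, $w=(k,\varepsilon)$ is an arithmetic $R$-weight, $r\ge 1$, the character $\chi\omega^{2-k}\varepsilon$ is defined modulo $Np^r$, and $\xi_w\in M_k(Np^r,\chi\omega^{2-k}\varepsilon,\mathbb C_p)$ (or $\xi_w\in S_k(Np^r,\chi\omega^{2-k}\varepsilon,\mathbb C_p)$), then $(e\xi)_w$ lies in the same space and is the classical ordinary projection $\lim_n U_p^{n!}(\xi_w)$ of $\xi_w$ (limit for the $p$-adic sup-norm on $q$-expansions). (iv) If $\Omega'\subseteq\Omega$ are admissible, then $\mathbb M_\Omega\subseteq\mathbb M_{\Omega'}$, and the endomorphism $e$ of $\mathbb M_{\Omega'}$ restricts to that of $\mathbb M_\Omega$. The same assertions hold with $\mathbb S$ in place of $\mathbb M$. -/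

import Mathlib

noncomputable section

namespace LambdaAdic

open scoped PowerSeries CongruenceSubgroup MatrixGroups ModularForm UpperHalfPlane

/-! ### The Teichmüller character and exponentiation on `1 + pℤ_p` -/

section Padic

variable (p : ℕ) [Fact p.Prime]

/-- The Teichmüller character `ω : (ℤ/p)ˣ → ℤ_pˣ`, extended by zero as a Dirichlet character. -/
def teich : DirichletCharacter ℤ_[p] p where
  toFun a := WittVector.equiv p (WittVector.teichmuller p a)
  map_one' := by simp
  map_mul' a b := by simp
  map_nonunit' a ha := by
    have h0 : a = 0 := by
      by_contra h
      exact ha (isUnit_iff_ne_zero.mpr h)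
    subst h0
    simp

/-- `ω(a)` reduces to `a` modulo `p`. -/
theorem toZMod_teich (a : ZMod p) : PadicInt.toZMod (teich p a) = a := by
  have key : ∀ g : ℤ_[p] →+* ZMod p, g = PadicInt.toZMod := by
    intro g
    ext x
    have hx := PadicInt.sub_zmodRepr_mem x
    rw [PadicInt.maximalIdeal_eq_span_p, Ideal.mem_span_singleton] at hx
    obtain ⟨y, hy⟩ := hx
    have h1 : x = (x.zmodRepr : ℤ_[p]) + (p : ℤ_[p]) * y := by rw [← hy]; ring
    rw [h1]
    simp
  have h := congrArg (fun g : ℤ_[p] →+* ZMod p => g (teich p a))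
    (key ((WittVector.constantCoeff (p := p)).comp (WittVector.equiv p).symm.toRingHom))
  refine h.symm.trans ?_
  change WittVector.constantCoeff ((WittVector.equiv p).symm
    (WittVector.equiv p (WittVector.teichmuller p a))) = a
  simp [WittVector.constantCoeff]

theorem tendsto_p_pow :
    Filter.Tendsto (fun n : ℕ => (p : ℤ_[p]) ^ n) Filter.atTop (nhds 0) := by
  apply tendsto_pow_atTop_nhds_zero_of_norm_lt_one
  rw [PadicInt.norm_p]
  exact inv_lt_one_of_one_lt₀ (by exact_mod_cast (Fact.out : p.Prime).one_lt)

/-- The continuous character `s ↦ (1 + p) ^ s` of `ℤ_p`. -/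
def onePlusP : AddChar ℤ_[p] ℤ_[p] :=
  PadicInt.addChar_of_value_at_one (p : ℤ_[p]) (tendsto_p_pow p)

theorem onePlusP_natCast (n : ℕ) : onePlusP p n = (1 + (p : ℤ_[p])) ^ n := by
  have h : onePlusP p (1 : ℤ_[p]) = 1 + (p : ℤ_[p]) :=
    PadicInt.addChar_of_value_at_one_def (tendsto_p_pow p)
  rw [← h, ← AddChar.map_nsmul_eq_pow]
  simp

theorem one_add_mul_pow_dvd (c : ℤ_[p]) (j : ℕ) :
    c ^ 2 ∣ (1 + c) ^ j - (1 + j * c) := by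
  induction j with
  | zero => simp
  | succ j ih =>
    obtain ⟨d, hd⟩ := ih
    refine ⟨d * (1 + c) + j, ?_⟩
    have : (1 + c) ^ j = c ^ 2 * d + (1 + j * c) := by rw [← hd]; ring
    rw [pow_succ, this]
    push_cast
    ring

/-- For `p` odd every `u ∈ 1 + pℤ_p` is of the form `(1 + p) ^ s` with `s ∈ ℤ_p`. -/
theorem exists_onePlusP_eq (hp : 3 ≤ p) (u : ℤ_[p]) (hu : PadicInt.toZMod u = 1) :
    ∃ s : ℤ_[p], onePlusP p s = u := by
  have hmem : ∀ x : ℤ_[p], PadicInt.toZMod x = 0 ↔ (p : ℤ_[p]) ∣ x := by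
    intro x
    rw [← RingHom.mem_ker, PadicInt.ker_toZMod, PadicInt.maximalIdeal_eq_span_p,
      Ideal.mem_span_singleton]
  have approx : ∀ n : ℕ, ∃ m : ℕ, (p : ℤ_[p]) ^ (n + 1) ∣ u - (1 + (p : ℤ_[p])) ^ m := by
    intro n
    induction n with
    | zero =>
      refine ⟨0, ?_⟩
      rw [zero_add, pow_one, ← hmem]
      simp [hu]
    | succ n ih =>
      obtain ⟨m, c, hc⟩ := ih
      obtain ⟨y, hy⟩ := ZMod.exists_one_add_mul_pow_prime_pow_eq (R := ℤ_[p]) (p := p)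
        (u := (p : ℤ_[p])) (v := (p : ℤ_[p])) Fact.out dvd_rfl
        (by
          rw [show (p : ℤ_[p]) * p * p = (p : ℤ_[p]) ^ 3 by ring]
          exact pow_dvd_pow _ hp) 1 n
      rw [mul_one] at hy
      set j := c.zmodRepr with hj
      refine ⟨m + p ^ n * j, ?_⟩
      have h2 := one_add_mul_pow_dvd p ((p : ℤ_[p]) ^ n * p * (1 + p * y)) j
      obtain ⟨d, hd⟩ := h2
      have h3 : (1 + (p : ℤ_[p])) ^ (p ^ n * j) =
          1 + j * ((p : ℤ_[p]) ^ n * p * (1 + p * y)) +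
            ((p : ℤ_[p]) ^ n * p * (1 + p * y)) ^ 2 * d := by
        rw [pow_mul, hy, ← hd]; ring
      have h4 : (p : ℤ_[p]) ∣ (1 + (p : ℤ_[p])) ^ m - 1 := by
        rw [← hmem]; simp
      obtain ⟨e, he⟩ := h4
      have h5 := PadicInt.sub_zmodRepr_mem c
      rw [PadicInt.maximalIdeal_eq_span_p, Ideal.mem_span_singleton] at h5
      obtain ⟨f, hf⟩ := h5
      have hc' : c = j + p * f := by rw [← hf]; ring
      have he' : (1 + (p : ℤ_[p])) ^ m = 1 + p * e := by rw [← he]; ring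
      have hu' : u = (1 + (p : ℤ_[p])) ^ m + (p : ℤ_[p]) ^ (n + 1) * (j + p * f) := by
        rw [← hc', ← hc]; ring
      rw [pow_add (1 + (p : ℤ_[p])) m, h3, hu', he']
      refine ⟨f - e * j - j * y - p * e * j * y
        - (1 + p * e) * ((p : ℤ_[p]) ^ n * (1 + p * y) ^ 2 * d), ?_⟩
      ring
  have hclosed : IsClosed (Set.range (onePlusP p)) := by
    apply IsCompact.isClosed
    apply isCompact_range
    exact PadicInt.continuous_addChar_of_value_at_one (tendsto_p_pow p)
  have : u ∈ Set.range (onePlusP p) := by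
    rw [← hclosed.closure_eq, Metric.mem_closure_iff]
    intro ε hε
    have ht := (tendsto_p_pow p).norm
    rw [norm_zero] at ht
    obtain ⟨n, hn⟩ := ((ht.eventually_lt_const hε).and (Filter.eventually_ge_atTop 1)).exists
    obtain ⟨m, hm⟩ := approx n
    refine ⟨_, ⟨(m : ℤ_[p]), rfl⟩, ?_⟩
    rw [onePlusP_natCast, dist_eq_norm]
    obtain ⟨c, hc⟩ := hm
    rw [hc, pow_succ, mul_assoc, norm_mul]
    refine lt_of_le_of_lt ?_ hn.1
    exact mul_le_of_le_one_right (norm_nonneg _) (PadicInt.norm_le_one _)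
  exact this

/-- For an integer `a` prime to `p`, the `s ∈ ℤ_p` with `(1 + p) ^ s = a ω(a)⁻¹`. -/
def angleExponent (a : ℕ) : ℤ_[p] :=
  Classical.epsilon fun s : ℤ_[p] => onePlusP p s = (a : ℤ_[p]) * (teich p)⁻¹ (a : ZMod p)

theorem onePlusP_angleExponent (hp : 3 ≤ p) (a : ℕ) (ha : a.Coprime p) :
    onePlusP p (angleExponent p a) = (a : ℤ_[p]) * (teich p)⁻¹ (a : ZMod p) := by
  refine Classical.epsilon_spec
    (p := fun s : ℤ_[p] => onePlusP p s = (a : ℤ_[p]) * (teich p)⁻¹ (a : ZMod p)) ?_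
  apply exists_onePlusP_eq p hp
  have hu : IsUnit (a : ZMod p) := (ZMod.isUnit_iff_coprime a p).mpr ha
  have h0 : (a : ZMod p) ≠ 0 := hu.ne_zero
  rw [map_mul, map_natCast, MulChar.inv_apply', toZMod_teich]
  exact mul_inv_cancel₀ h0

end Padic
/-! ### Classical modular forms with coefficients in `ℂ_p` -/

section Classical

/-- The two kinds of forms: all modular forms, or cusp forms only. -/
inductive FormKind
  | modular
  | cuspidal

/-- `F ∈ ℂ⟦q⟧` is the `q`-expansion (at `∞`, in `q = exp (2πiτ)`) of a holomorphic modular form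
(resp. cusp form) of weight `k`, level `Γ₁(M)` and nebentypus `ψ`. -/
def IsClassicalQExpansion (κ : FormKind) (M k : ℕ) (ψ : DirichletCharacter ℂ M) (F : ℂ⟦X⟧) :
    Prop :=
  match κ with
  | .modular =>
    ∃ f : ModularForm
        ((CongruenceSubgroup.Gamma1 M).map (Matrix.SpecialLinearGroup.mapGL ℝ)) (k : ℤ),
      (∀ γ ∈ CongruenceSubgroup.Gamma0 M,
        (⇑f) ∣[(k : ℤ)] γ = ψ ((γ 1 1 : ℤ) : ZMod M) • (⇑f)) ∧
      UpperHalfPlane.qExpansion 1 f = F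
  | .cuspidal =>
    ∃ f : CuspForm
        ((CongruenceSubgroup.Gamma1 M).map (Matrix.SpecialLinearGroup.mapGL ℝ)) (k : ℤ),
      (∀ γ ∈ CongruenceSubgroup.Gamma0 M,
        (⇑f) ∣[(k : ℤ)] γ = ψ ((γ 1 1 : ℤ) : ZMod M) • (⇑f)) ∧
      UpperHalfPlane.qExpansion 1 f = F

variable (p : ℕ) [Fact p.Prime]

/-- The space `M_k(M, ψ, ℂ_p)` (resp. `S_k(M, ψ, ℂ_p)`), as a space of `q`-expansions: the
`ℂ_p`-span of the images under `ιp` of the `q`-expansions of the classical forms of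
weight `k`, level `M` and nebentypus `ψ` whose coefficients are algebraic. Algebraic numbers are
viewed in `ℂ` via `ιinf` and in `ℂ_p` via `ιp`. -/
def classicalForms (ιp : AlgebraicClosure ℚ →+* PadicAlgCl p) (ιinf : AlgebraicClosure ℚ →+* ℂ)
    (κ : FormKind) (M k : ℕ) (ψ : DirichletCharacter ℂ_[p] M) :
    Submodule ℂ_[p] ℂ_[p]⟦X⟧ :=
  Submodule.span ℂ_[p]
    { F | ∃ (ψ₀ : DirichletCharacter (AlgebraicClosure ℚ) M) (A : (AlgebraicClosure ℚ)⟦X⟧),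
        ψ₀.ringHomComp ((algebraMap (PadicAlgCl p) ℂ_[p]).comp ιp) = ψ ∧
        IsClassicalQExpansion κ M k (ψ₀.ringHomComp ιinf) (PowerSeries.map ιinf A) ∧
        PowerSeries.map ((algebraMap (PadicAlgCl p) ℂ_[p]).comp ιp) A = F }

/-- The operator `U_p` on formal `q`-expansions: `∑ aₙ qⁿ ↦ ∑ aₙₚ qⁿ`. -/
def heckeU (R : Type*) [CommRing R] : R⟦X⟧ →ₗ[R] R⟦X⟧ where
  toFun ξ := PowerSeries.mk fun n => PowerSeries.coeff (n * p) ξ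
  map_add' ξ ζ := by ext n; simp
  map_smul' r ξ := by ext n; simp

/-- `G = lim U_p^{n!} F` for the `p`-adic topology on `q`-expansions over `ℂ_p`, i.e. uniformly in
all coefficients: `G` is the image of `F` under the classical ordinary projector. -/
def IsClassicalOrdinaryProjection (F G : ℂ_[p]⟦X⟧) : Prop :=
  ∀ δ : ℝ, 0 < δ → ∃ n₀ : ℕ, ∀ n ≥ n₀, ∀ i : ℕ,
    ‖PowerSeries.coeff i (((heckeU p ℂ_[p]) ^ n.factorial) F - G)‖ < δ

end Classical

/-! ### Coefficient rings and their weights -/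

section Weights

variable (p : ℕ) [Fact p.Prime] (L : IntermediateField ℚ_[p] (PadicAlgCl p))

/-- The ring of integers `𝒪_L` of `L`. -/
abbrev IntRing : Subalgebra ℤ_[p] L := integralClosure ℤ_[p] L

/-- The Iwasawa algebra `Λ = 𝒪_L⟦1 + pℤ_p⟧`, identified with `𝒪_L⟦T⟧` by `[1 + p] ↦ 1 + T`. -/
abbrev Iw : Type := PowerSeries (IntRing p L)

/-- The inclusion `𝒪_L ⊆ ℂ_p`. -/
def toCp : IntRing p L →+* ℂ_[p] :=
  ((algebraMap (PadicAlgCl p) ℂ_[p]).comp (algebraMap L (PadicAlgCl p))).comp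
    (algebraMap (IntRing p L) L)

variable (R : Type*) [CommRing R] [IsLocalRing R] [Algebra (Iw p L) R]

/-- A (`ℂ_p`-valued) `R`-weight: a ring homomorphism `R → ℂ_p` that is continuous for the
`𝔪`-adic topology of `R` and a homomorphism of `𝒪_L`-algebras. -/
structure Weight extends R →+* ℂ_[p] where
  map_const : ∀ a : IntRing p L,
    toRingHom (algebraMap (Iw p L) R (PowerSeries.C a)) = toCp p L a
  continuous_adic :
    @Continuous R ℂ_[p] (IsLocalRing.maximalIdeal R).adicTopology _ toRingHom

variable {p L R}

/-- The restriction of `w` to `Λ` is the arithmetic weight `(k, ε)`, i.e. sends `T` to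
`ε(1 + p)(1 + p)ᵏ - 1`. A finite order character `ε` of `1 + pℤ_p` is given as a Dirichlet
character modulo a power of `p` and of `p`-power order, by composition
with `ℤ_pˣ → 1 + pℤ_p, a ↦ a ω(a)⁻¹`. -/
def Weight.IsArithmetic (w : Weight p L R) (k : ℕ) {m : ℕ}
    (ε : DirichletCharacter ℂ_[p] (p ^ m)) : Prop :=
  1 ≤ k ∧ (∃ j : ℕ, ε ^ p ^ j = 1) ∧
    w.toRingHom (algebraMap (Iw p L) R PowerSeries.X) =
      ε ((1 + p : ℕ) : ZMod (p ^ m)) * (1 + (p : ℂ_[p])) ^ k - 1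

/-- The restriction of `w` to `Λ` is the integral classical weight `k ≥ 2`, i.e. sends `T` to
`(1 + p)ᵏ - 1`. -/
def Weight.IsIntegralClassical (w : Weight p L R) (k : ℕ) : Prop :=
  2 ≤ k ∧ w.toRingHom (algebraMap (Iw p L) R PowerSeries.X) = (1 + (p : ℂ_[p])) ^ k - 1

/-- A set of integral classical `R`-weights is `(Λ, R)`-admissible if the closure in `ℤ_p` of the
set of its weights contains a non-empty open set, and the kernels of its elements
intersect trivially. -/
structure IsAdmissible (Ω : Set (Weight p L R)) : Prop where
  classical : ∀ w ∈ Ω, ∃ k : ℕ, w.IsIntegralClassical k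
  open_closure : (interior (closure
    {z : ℤ_[p] | ∃ w ∈ Ω, ∃ k : ℕ, w.IsIntegralClassical k ∧ z = k})).Nonempty
  ker_inf : ⨅ w ∈ Ω, RingHom.ker w.toRingHom = ⊥

end Weights

/-! ### Generalized `Λ`-adic forms -/

section Forms

variable {p : ℕ} [Fact p.Prime] {L : IntermediateField ℚ_[p] (PadicAlgCl p)}

/-- `ω` with values in `ℂ_p`. -/
def teichCp (p : ℕ) [Fact p.Prime] : DirichletCharacter ℂ_[p] p :=
  (teich p).ringHomComp ((algebraMap ℚ_[p] ℂ_[p]).comp PadicInt.Coe.ringHom)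

/-- The Dirichlet character `χ ω^{2-k} ε`, of modulus `M`, where `χ` has modulus `M'`, with values
in `𝒪_L`, and `ε` has modulus `p ^ m`: the values are prescribed on the integers prime to `N p`. -/
def IsNebentypus {M' M m : ℕ} (N k : ℕ) (χ : DirichletCharacter (IntRing p L) M')
    (ε : DirichletCharacter ℂ_[p] (p ^ m)) (ψ : DirichletCharacter ℂ_[p] M) : Prop :=
  ∀ a : ℕ, a.Coprime (N * p) →
    ψ (a : ZMod M) =
      toCp p L (χ (a : ZMod M')) * teichCp p (a : ZMod p) ^ (2 - (k : ℤ)) * ε (a : ZMod (p ^ m))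

/-- The Dirichlet character `χ ω^{2-k}` modulo `N pᵗ`, with values in `ℂ_p`. -/
def nebentypus {N t : ℕ} (ht : 1 ≤ t) (χ : DirichletCharacter (IntRing p L) (N * p ^ t)) (k : ℕ) :
    DirichletCharacter ℂ_[p] (N * p ^ t) :=
  χ.ringHomComp (toCp p L) *
    DirichletCharacter.changeLevel (dvd_mul_of_dvd_right (dvd_pow_self p (by omega)) N)
      (teichCp p ^ (2 - (k : ℤ)))

variable {R : Type*} [CommRing R] [IsLocalRing R] [Algebra (Iw p L) R]

/-- The `R`-module `𝕄_Ω(N, χ, R)` (resp. `𝕊_Ω(N, χ, R)`) of generalized `Λ`-adic forms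
(resp. cuspidal ones) that are `Ω`-compatible: the `ξ ∈ R⟦q⟧` whose specialization `ξ_w` lies in
`M_k(N pᵗ, χ ω^{2-k}, ℂ_p)` (resp. `S_k(N pᵗ, χ ω^{2-k}, ℂ_p)`), `k` the weight of `w`,
for all `w ∈ Ω`. -/
def forms (ιp : AlgebraicClosure ℚ →+* PadicAlgCl p) (ιinf : AlgebraicClosure ℚ →+* ℂ)
    (κ : FormKind) {N t : ℕ} (ht : 1 ≤ t) (χ : DirichletCharacter (IntRing p L) (N * p ^ t))
    (Ω : Set (Weight p L R)) : Submodule R R⟦X⟧ where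
  carrier := { ξ | ∀ w ∈ Ω, ∀ k : ℕ, w.IsIntegralClassical k →
    PowerSeries.map w.toRingHom ξ ∈ classicalForms p ιp ιinf κ (N * p ^ t) k (nebentypus ht χ k) }
  add_mem' {ξ ζ} hξ hζ w hw k hk := by
    rw [map_add]
    exact add_mem (hξ w hw k hk) (hζ w hw k hk)
  zero_mem' w _ k _ := by
    rw [map_zero]
    exact zero_mem _
  smul_mem' r ξ hξ w hw k hk := by
    have h : PowerSeries.map w.toRingHom (r • ξ) =
        w.toRingHom r • PowerSeries.map w.toRingHom ξ := by
      ext n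
      simp
    rw [h]
    exact Submodule.smul_mem _ _ (hξ w hw k hk)

/-- The element `⟨a⟩ = [a ω(a)⁻¹]` of `Λ = 𝒪_L⟦T⟧`, for `a` prime to `p`: the
series `(1 + T) ^ s`, where `(1 + p) ^ s = a ω(a)⁻¹`. -/
def angle (p : ℕ) [Fact p.Prime] (L : IntermediateField ℚ_[p] (PadicAlgCl p)) (a : ℕ) : Iw p L :=
  PowerSeries.binomialSeries (IntRing p L) (angleExponent p a)

/-- The coefficient `⟨ℓ⟩ χ(ℓ) ω(ℓ)² ℓ⁻¹ ∈ Λ`, which has specialization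
`(χ ω^{2-k})(ℓ) ℓ^{k-1}` in weight `k`. -/
def heckeCoeff {M : ℕ} (χ : DirichletCharacter (IntRing p L) M) (ℓ : ℕ) : Iw p L :=
  angle p L ℓ * PowerSeries.C (χ (ℓ : ZMod M) *
    algebraMap ℤ_[p] (IntRing p L) (teich p (ℓ : ZMod p) ^ 2 * Ring.inverse (ℓ : ℤ_[p])))

/-- The Hecke operator `T_ℓ` on `q`-expansions over `R`, for `ℓ` a prime not dividing `N p`:
`aₙ(T_ℓ ξ) = a_{nℓ}(ξ) + ⟨ℓ⟩ χ(ℓ) ω(ℓ)² ℓ⁻¹ a_{n/ℓ}(ξ)`, the last term being present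
only if `ℓ ∣ n`. -/
def heckeT (R : Type*) [CommRing R] [Algebra (Iw p L) R]
    {M : ℕ} (χ : DirichletCharacter (IntRing p L) M) (ℓ : ℕ) : R⟦X⟧ →ₗ[R] R⟦X⟧ where
  toFun ξ := PowerSeries.mk fun n => PowerSeries.coeff (n * ℓ) ξ +
    if ℓ ∣ n then algebraMap (Iw p L) R (heckeCoeff χ ℓ) * PowerSeries.coeff (n / ℓ) ξ else 0
  map_add' ξ ζ := by
    ext n
    by_cases h : ℓ ∣ n
    · simp [h]; ring
    · simp [h]
  map_smul' r ξ := by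
    ext n
    by_cases h : ℓ ∣ n
    · simp [h]; ring
    · simp [h]

/-- Convergence `uₙ → ξ` in `R⟦q⟧` for the `𝔪`-adic topology. -/
def MAdicTendsto {R : Type*} [CommRing R] [IsLocalRing R] (u : ℕ → R⟦X⟧) (ξ : R⟦X⟧) : Prop :=
  ∀ j : ℕ, ∃ n₀ : ℕ, ∀ n ≥ n₀,
    u n - ξ ∈ ((IsLocalRing.maximalIdeal R) ^ j • ⊤ : Submodule R R⟦X⟧)

/-- `e(ξ) = lim U_p^{n!}(ξ)` for all `ξ` in the module `𝕄 ⊆ R⟦q⟧`, for the `𝔪`-adic topology. -/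
def IsOrdLimit (p : ℕ) {R : Type*} [CommRing R] [IsLocalRing R] {𝕄 : Submodule R R⟦X⟧}
    (e : Module.End R 𝕄) : Prop :=
  ∀ ξ : 𝕄, MAdicTendsto (fun n => ((heckeU p R) ^ n.factorial) (ξ : R⟦X⟧)) (e ξ : R⟦X⟧)

end Forms

end LambdaAdic

end

/-!
The proof has a formal part, an ordinary projector for a profinite filtered module, and two inputs
from the classical theory of modular forms, the Hecke action and the Sturm bound.

*The projector.* Let `D j` be a filtration of a module by `U`-stable submodules of finite
index, for which the module is separated and complete. On each finite quotient the powers of `U` are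
eventually periodic, so that `U^{n!}` and `U^{n!-1}` stabilize; their limits `e` and `V` satisfy
`U V = V U = e`, whence `U` is invertible on the image of `e` and topologically nilpotent on its
complement (`exists_ordinary_projector`). Everything that commutes with `U` and preserves the
filtration commutes with `e`.

*The filtration.* The result is applied to `𝕄` with `D j = 𝕄 ∩ 𝔪ʲ R⟦q⟧`, and the main point is that
the quotients `𝕄 / D j` are finite. The ring `R` has finite residue field and is therefore compact;
since the kernels of the weights in `Ω` are closed with trivial intersection, finitely many of them
already intersect inside `𝔪ʲ` (Chevalley's theorem, `exists_finset_iInf_ker_le`). At each of these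
finitely many weights a classical form vanishes as soon as a bounded number of its coefficients do.
Hence an element of `𝕄` lies in `D j` when finitely many of its coefficients vanish at finitely many
weights, so `𝕄 / D j` is a finitely generated module over the finite ring `R / 𝔪ʲ`
(`finite_forms_quotient`). The same property of the coefficients shows that the classical spaces are
closed under coefficientwise limits (`mem_classicalForms_of_tendsto`), which gives the completeness
of `𝕄` and the compatibility of `e` with arithmetic specializations.

*Classical input.* That finitely many coefficients determine a form for `Γ₁(M)`
(`exists_sturm_bound`) follows from the level one case applied to the norm of the form. The Hecke
operator at a prime `q` is the sum of the slash actions of the `q + 1` matrices indexed by the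
projective line over `ℤ/q`, permuted by the right action of `SL₂(ℤ)` on row vectors
(`HasNebentypus.heckeFun`); the case `q ∣ M` gives `U_q`.

*Specialization of `T_ℓ`.* An integral classical weight `k` sends `(1 + T)ⁿ` to `(1 + p)^{kn}` for natural
numbers `n`, and by continuity the same holds for exponents in `ℤ_p`
(`Weight.map_binomialSeries`). Therefore `⟨ℓ⟩ χ(ℓ) ω(ℓ)² ℓ⁻¹` specializes to
`(χ ω^{2-k})(ℓ) ℓ^{k-1}`, and `T_ℓ` to the classical Hecke operator.
-/

namespace LambdaAdic

open scoped PowerSeries CongruenceSubgroup MatrixGroups ModularForm UpperHalfPlane Manifold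

/-! ### Ordinary projectors on filtered modules -/

section OrdinaryProjector

variable {R M : Type*} [CommRing R] [AddCommGroup M] [Module R M]

/-- Powers of a self-map of a finite set are eventually periodic. -/
theorem exists_iterate_periodic {X : Type*} [Finite X] (f : X → X) :
    ∃ s d : ℕ, 0 < d ∧ ∀ a b : ℕ, s ≤ a → s ≤ b → a ≡ b [MOD d] → f^[a] = f^[b] := by
  obtain ⟨m, n, hmn, h⟩ : ∃ m n : ℕ, m < n ∧ f^[m] = f^[n] := by
    obtain ⟨m, n, hne, h⟩ := Finite.exists_ne_map_eq_of_infinite (fun n : ℕ => f^[n])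
    rcases lt_or_gt_of_ne hne with hlt | hlt
    · exact ⟨m, n, hlt, h⟩
    · exact ⟨n, m, hlt, h.symm⟩
  have step : ∀ k i : ℕ, f^[m + i + (n - m) * k] = f^[m + i] := by
    intro k i
    induction k with
    | zero => simp
    | succ k ih =>
      rw [← ih, show m + i + (n - m) * (k + 1) = (i + (n - m) * k) + n by
        rw [mul_add, mul_one]; omega, Function.iterate_add, ← h, ← Function.iterate_add]
      congr 1
      omega
  have main : ∀ a b : ℕ, m ≤ a → a ≤ b → a ≡ b [MOD n - m] → f^[a] = f^[b] := by
    intro a b ha hab hmod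
    obtain ⟨k, hk⟩ := (Nat.modEq_iff_dvd' hab).mp hmod
    have := step k (a - m)
    rw [show m + (a - m) = a by omega, show a + (n - m) * k = b by omega] at this
    exact this.symm
  refine ⟨m, n - m, by omega, fun a b ha hb hab => ?_⟩
  rcases le_total a b with h' | h'
  · exact main a b ha h' hab
  · exact (main b a hb h' hab.symm).symm

theorem pow_mem_of_map_le {U : Module.End R M} {D : Submodule R M} (hU : ∀ x ∈ D, U x ∈ D)
    (n : ℕ) {x : M} (hx : x ∈ D) : (U ^ n) x ∈ D := by
  induction n with
  | zero => simpa using hx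
  | succ n ih => rw [pow_succ', Module.End.mul_apply]; exact hU _ ih

/-- The powers of an endomorphism are eventually periodic modulo a stable submodule of finite
index. -/
theorem exists_pow_periodic_mod (U : Module.End R M) (D : Submodule R M) [Finite (M ⧸ D)]
    (hU : ∀ x ∈ D, U x ∈ D) :
    ∃ s d : ℕ, 0 < d ∧ ∀ a b : ℕ, s ≤ a → s ≤ b → a ≡ b [MOD d] →
      ∀ x, (U ^ a) x - (U ^ b) x ∈ D := by
  obtain ⟨s, d, hd, h⟩ := exists_iterate_periodic (D.mapQ D U hU)
  refine ⟨s, d, hd, fun a b ha hb hab x => ?_⟩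
  have key : ∀ n : ℕ, (D.mapQ D U hU)^[n] (D.mkQ x) = D.mkQ ((U ^ n) x) := by
    intro n
    induction n with
    | zero => simp
    | succ n ih => rw [Function.iterate_succ_apply', ih, pow_succ', Module.End.mul_apply]; simp
  have h2 := congrFun (h a b ha hb hab) (D.mkQ x)
  rw [key, key] at h2
  exact (Submodule.Quotient.eq D).mp h2

/-- A sequence of exponents whose powers of an endomorphism of a finite set stabilize: it tends
to infinity and is eventually constant modulo every positive integer. -/
def StabilizingExponents (g : ℕ → ℕ) : Prop :=
  ∀ s d : ℕ, 0 < d → ∃ n₀ : ℕ, ∀ n ≥ n₀, s ≤ g n ∧ g n ≡ g n₀ [MOD d]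

theorem stabilizingExponents_factorial : StabilizingExponents Nat.factorial := by
  intro s d hd
  refine ⟨max s d, fun n hn => ⟨?_, ?_⟩⟩
  · exact (le_trans (le_max_left s d) hn).trans (Nat.self_le_factorial n)
  · have h1 : ∀ m ≥ max s d, m.factorial ≡ 0 [MOD d] := fun m hm =>
      (Nat.modEq_zero_iff_dvd).mpr (Nat.dvd_factorial hd ((le_max_right s d).trans hm))
    exact (h1 n hn).trans (h1 _ le_rfl).symm

theorem stabilizingExponents_factorial_sub_one :
    StabilizingExponents fun n => n.factorial - 1 := by
  intro s d hd
  obtain ⟨n₀, h⟩ := stabilizingExponents_factorial (s + 1) d hd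
  refine ⟨n₀, fun n hn => ⟨Nat.le_sub_one_of_lt (h n hn).1, ?_⟩⟩
  refine Nat.ModEq.add_right_cancel' 1 ?_
  rw [Nat.sub_add_cancel (Nat.factorial_pos _), Nat.sub_add_cancel (Nat.factorial_pos _)]
  exact (h n hn).2

/-- A module is complete and separated for a filtration with finite quotients. Completeness is
stated for sequences that are Cauchy with respect to every step of the filtration. -/
structure IsProfiniteFiltration (D : ℕ → Submodule R M) : Prop where
  finite : ∀ j, Finite (M ⧸ D j)
  separated : ∀ x, (∀ j, x ∈ D j) → x = 0
  complete : ∀ u : ℕ → M, (∀ j, ∃ n₀, ∀ n ≥ n₀, u n - u n₀ ∈ D j) →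
    ∃ y, ∀ j, ∃ n₀, ∀ n ≥ n₀, u n - y ∈ D j

variable {D : ℕ → Submodule R M} {U : Module.End R M}

/-- `u` converges to `y` for the filtration `D`. -/
def FiltTendsto (D : ℕ → Submodule R M) (u : ℕ → M) (y : M) : Prop :=
  ∀ j, ∃ n₀, ∀ n ≥ n₀, u n - y ∈ D j

theorem FiltTendsto.unique (hD : IsProfiniteFiltration D) {u : ℕ → M} {y z : M}
    (hy : FiltTendsto D u y) (hz : FiltTendsto D u z) : y = z := by
  refine sub_eq_zero.mp (hD.separated _ fun j => ?_)
  obtain ⟨n₁, h₁⟩ := hy j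
  obtain ⟨n₂, h₂⟩ := hz j
  have := (D j).sub_mem (h₂ (max n₁ n₂) (le_max_right _ _)) (h₁ (max n₁ n₂) (le_max_left _ _))
  simpa using this

theorem FiltTendsto.congr {u v : ℕ → M} {y : M} (hy : FiltTendsto D u y) (h : ∀ n, u n = v n) :
    FiltTendsto D v y :=
  (funext h : u = v) ▸ hy

theorem FiltTendsto.add {u v : ℕ → M} {y z : M} (hy : FiltTendsto D u y)
    (hz : FiltTendsto D v z) : FiltTendsto D (fun n => u n + v n) (y + z) := by
  intro j
  obtain ⟨n₁, h₁⟩ := hy j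
  obtain ⟨n₂, h₂⟩ := hz j
  refine ⟨max n₁ n₂, fun n hn => ?_⟩
  rw [add_sub_add_comm]
  exact (D j).add_mem (h₁ n ((le_max_left _ _).trans hn)) (h₂ n ((le_max_right _ _).trans hn))

theorem FiltTendsto.map {T : Module.End R M} (hT : ∀ j, ∀ x ∈ D j, T x ∈ D j) {u : ℕ → M} {y : M}
    (hy : FiltTendsto D u y) : FiltTendsto D (fun n => T (u n)) (T y) := by
  intro j
  obtain ⟨n₁, h₁⟩ := hy j
  refine ⟨n₁, fun n hn => ?_⟩
  rw [← map_sub]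
  exact hT j _ (h₁ n hn)

/-- For a stabilizing sequence of exponents, the powers of `U` converge, uniformly on `M`. -/
theorem exists_limit_pow (hD : IsProfiniteFiltration D) (hU : ∀ j, ∀ x ∈ D j, U x ∈ D j)
    {g : ℕ → ℕ} (hg : StabilizingExponents g) :
    ∃ E : Module.End R M, ∀ j, ∃ n₀, ∀ n ≥ n₀, ∀ x, (U ^ g n) x - E x ∈ D j := by
  have unif : ∀ j, ∃ n₀, ∀ n ≥ n₀, ∀ x, (U ^ g n) x - (U ^ g n₀) x ∈ D j := by
    intro j
    have := hD.finite j
    obtain ⟨s, d, hd, h⟩ := exists_pow_periodic_mod U (D j) (hU j)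
    obtain ⟨n₀, hn₀⟩ := hg s d hd
    exact ⟨n₀, fun n hn x => h _ _ (hn₀ n hn).1 (hn₀ n₀ le_rfl).1 (hn₀ n hn).2 x⟩
  have lim : ∀ x, ∃ y, FiltTendsto D (fun n => (U ^ g n) x) y := fun x =>
    hD.complete (fun n => (U ^ g n) x) fun j =>
      let ⟨n₀, h⟩ := unif j
      ⟨n₀, fun n hn => h n hn x⟩
  choose E hE using lim
  refine ⟨{ toFun := E, map_add' := fun x y => ?_, map_smul' := fun r x => ?_ }, fun j => ?_⟩
  · refine FiltTendsto.unique hD (hE (x + y)) ?_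
    simpa using (hE x).add (hE y)
  · refine FiltTendsto.unique hD (hE (r • x)) ?_
    simpa using (hE x).map (T := r • (1 : Module.End R M))
      (fun j x hx => (D j).smul_mem r hx)
  · obtain ⟨n₀, h⟩ := unif j
    refine ⟨n₀, fun n hn x => ?_⟩
    obtain ⟨n₁, h₁⟩ := hE x j
    have h2 := (D j).sub_mem (h n hn x) (h (max n n₁) (hn.trans (le_max_left _ _)) x)
    have h3 := (D j).add_mem h2 (h₁ (max n n₁) (le_max_right _ _))
    simpa using h3

/-- The ordinary projector `e = lim U^{n!}` attached to an endomorphism `U` of a module with a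
complete separated filtration by `U`-stable submodules of finite index. The endomorphism
`V = lim U^{n!-1}` is the inverse of `U` on the image of `e`. -/
theorem exists_ordinary_projector (hD : IsProfiniteFiltration D)
    (hU : ∀ j, ∀ x ∈ D j, U x ∈ D j) :
    ∃ e V : Module.End R M, IsIdempotentElem e ∧
      (∀ x, FiltTendsto D (fun n => (U ^ n.factorial) x) (e x)) ∧
      (∀ T : Module.End R M, (∀ j, ∀ x ∈ D j, T x ∈ D j) → Commute U T → Commute e T) ∧
      U * V = e ∧ Commute e V ∧ V * U = e ∧
      ∀ j, ∃ n₀, ∀ n ≥ n₀, ∀ x, (U ^ n) (x - e x) ∈ D j := by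
  obtain ⟨e, he⟩ := exists_limit_pow hD hU stabilizingExponents_factorial
  obtain ⟨V, hV⟩ := exists_limit_pow hD hU stabilizingExponents_factorial_sub_one
  have he' : ∀ x, FiltTendsto D (fun n => (U ^ n.factorial) x) (e x) := fun x j =>
    let ⟨n₀, h⟩ := he j
    ⟨n₀, fun n hn => h n hn x⟩
  have hV' : ∀ x, FiltTendsto D (fun n => (U ^ (n.factorial - 1)) x) (V x) := fun x j =>
    let ⟨n₀, h⟩ := hV j
    ⟨n₀, fun n hn => h n hn x⟩
  have hcomm : ∀ T : Module.End R M, (∀ j, ∀ x ∈ D j, T x ∈ D j) → Commute U T →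
      Commute e T := by
    intro T hT hUT
    ext x
    refine FiltTendsto.unique hD (he' (T x)) ?_
    refine ((he' x).map hT).congr fun n => ?_
    exact (LinearMap.congr_fun (hUT.pow_left n.factorial) x).symm
  have hUe : Commute e U := hcomm U hU (Commute.refl U)
  have hDe : ∀ j, ∀ x ∈ D j, e x ∈ D j := by
    intro j x hx
    obtain ⟨n₀, h⟩ := he j
    have h1 := (D j).sub_mem (pow_mem_of_map_le (hU j) n₀.factorial hx) (h n₀ le_rfl x)
    simpa using h1
  have hVU : V * U = e := by
    ext x
    refine FiltTendsto.unique hD (hV' (U x)) ?_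
    refine (he' x).congr fun n => ?_
    rw [← Module.End.mul_apply, ← pow_succ, Nat.sub_add_cancel (Nat.factorial_pos n)]
  have hUV : U * V = e := by
    ext x
    refine FiltTendsto.unique hD ((hV' x).map hU) ?_
    refine (he' x).congr fun n => ?_
    rw [← Module.End.mul_apply, ← pow_succ', Nat.sub_add_cancel (Nat.factorial_pos n)]
  have heV : Commute e V := by
    ext x
    refine (FiltTendsto.unique hD (hV' (e x)) ?_).symm
    refine ((hV' x).map hDe).congr fun n => ?_
    exact LinearMap.congr_fun (hUe.pow_right (n.factorial - 1)) x
  have hper : ∀ j, ∃ n₀, ∀ n ≥ n₀, ∀ x, (U ^ n) (x - e x) ∈ D j := by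
    intro j
    have := hD.finite j
    obtain ⟨s, d, hd, h⟩ := exists_pow_periodic_mod U (D j) (hU j)
    obtain ⟨n₀, h₀⟩ := he j
    refine ⟨s, fun n hn x => ?_⟩
    -- compare `Uⁿ` with `U^{n + N!}`, where `N!` is a multiple of the period `d`
    set N := max n₀ d
    have h1 := h₀ N (le_max_left _ _) x
    have h2 := pow_mem_of_map_le (hU j) n h1
    have h3 := h n (n + N.factorial) hn (by omega)
      ((Nat.modEq_iff_dvd' (by omega)).mpr (by
        rw [Nat.add_sub_cancel_left]; exact Nat.dvd_factorial hd (le_max_right _ _))) x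
    rw [pow_add, Module.End.mul_apply] at h3
    have h4 := (D j).add_mem h2 h3
    rw [map_sub] at h4 ⊢
    simpa using h4
  refine ⟨e, V, ?_, he', hcomm, hUV, heV, hVU, hper⟩
  -- `x - e x` is killed by `e`, because `Uⁿ (x - e x)` tends to `0`
  have hz : ∀ x, e (x - e x) = 0 := by
    intro x
    refine FiltTendsto.unique hD (he' (x - e x)) fun j => ?_
    obtain ⟨n₀, h⟩ := hper j
    exact ⟨n₀, fun n hn => by
      rw [sub_zero]; exact h _ (hn.trans (Nat.self_le_factorial n)) x⟩
  ext x
  have := hz x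
  rw [map_sub, sub_eq_zero] at this
  exact this.symm

end OrdinaryProjector

/-! ### Hecke operators on classical modular forms -/

section ClassicalHecke

open Matrix Matrix.SpecialLinearGroup UpperHalfPlane

/-- The matrices of determinant `q` in the double coset of the Hecke operator of index `q`,
indexed by the projective line over `ℤ/q`. -/
noncomputable def heckeMatrix (q : ℕ) [Fact q.Prime] (x : OnePoint (ZMod q)) : GL (Fin 2) ℚ :=
  x.elim
    (GeneralLinearGroup.mkOfDetNeZero !![(q : ℚ), 0; 0, 1] (by
      simpa using (Fact.out : q.Prime).ne_zero))
    fun j => GeneralLinearGroup.mkOfDetNeZero !![(1 : ℚ), j.val; 0, q] (by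
      simpa using (Fact.out : q.Prime).ne_zero)

variable {q : ℕ} [Fact q.Prime] {M : ℕ} {k : ℤ} {ψ : DirichletCharacter ℂ M} {f : ℍ → ℂ}

/-- `heckeMatrix` as a real matrix. -/
noncomputable def heckeMatrixReal (q : ℕ) [Fact q.Prime] (x : OnePoint (ZMod q)) :
    GL (Fin 2) ℝ :=
  (heckeMatrix q x).map (Rat.castHom ℝ)

theorem heckeMatrixReal_coe (j : ZMod q) :
    (heckeMatrixReal q (j : OnePoint (ZMod q)) : Matrix (Fin 2) (Fin 2) ℝ) =
      !![(1 : ℝ), j.val; 0, q] := by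
  have h : (heckeMatrix q (j : OnePoint (ZMod q)) : Matrix (Fin 2) (Fin 2) ℚ) =
    !![(1 : ℚ), j.val; 0, q] := rfl
  ext a b
  fin_cases a <;> fin_cases b <;> simp [heckeMatrixReal, h, -ZMod.natCast_val]

theorem heckeMatrixReal_infty :
    (heckeMatrixReal q OnePoint.infty : Matrix (Fin 2) (Fin 2) ℝ) = !![(q : ℝ), 0; 0, 1] := by
  have h : (heckeMatrix q OnePoint.infty : Matrix (Fin 2) (Fin 2) ℚ) =
    !![(q : ℚ), 0; 0, 1] := rfl
  ext a b
  fin_cases a <;> fin_cases b <;> simp [heckeMatrixReal, h, -ZMod.natCast_val]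

theorem det_heckeMatrixReal (x : OnePoint (ZMod q)) :
    (heckeMatrixReal q x : Matrix (Fin 2) (Fin 2) ℝ).det = q := by
  cases x with
  | infty => rw [heckeMatrixReal_infty]; simp [det_fin_two]
  | coe j => rw [heckeMatrixReal_coe]; simp [det_fin_two]

theorem sigma_heckeMatrixReal (x : OnePoint (ZMod q)) (z : ℂ) : σ (heckeMatrixReal q x) z = z := by
  have h : 0 < (heckeMatrixReal q x).det.val := by
    have : ((heckeMatrixReal q x).det : ℝ) = q := det_heckeMatrixReal x
    rw [this]
    exact_mod_cast (Fact.out : q.Prime).pos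
  simp only [σ, if_pos h]
  rfl

/-- The function `f` transforms under `Γ₀(M)` by the character `ψ` in weight `k`. -/
def HasNebentypus (f : ℍ → ℂ) (M : ℕ) (k : ℤ) (ψ : DirichletCharacter ℂ M) : Prop :=
  ∀ γ ∈ CongruenceSubgroup.Gamma0 M, f ∣[k] γ = ψ ((γ 1 1 : ℤ) : ZMod M) • f

/-- The summand of the Hecke operator at a point of the projective line. -/
noncomputable def heckeTerm (q : ℕ) [Fact q.Prime] (k : ℤ) (ψ : DirichletCharacter ℂ M)
    (f : ℍ → ℂ) (x : OnePoint (ZMod q)) : ℍ → ℂ :=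
  x.elim (ψ (q : ZMod M)) (fun _ => 1) • (f ∣[k] heckeMatrixReal q x)

theorem heckeTerm_coe (j : ZMod q) :
    heckeTerm q k ψ f j = f ∣[k] heckeMatrixReal q (j : OnePoint (ZMod q)) :=
  one_smul ℂ _

theorem heckeTerm_infty :
    heckeTerm q k ψ f OnePoint.infty =
      ψ (q : ZMod M) • (f ∣[k] heckeMatrixReal q OnePoint.infty) := rfl

/-- The Hecke operator `T_q`, or `U_q` if `q` divides the level, on functions on `ℍ`. -/
noncomputable def heckeFun (q : ℕ) [Fact q.Prime] (k : ℤ) (ψ : DirichletCharacter ℂ M)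
    (f : ℍ → ℂ) : ℍ → ℂ :=
  ∑ x : OnePoint (ZMod q), heckeTerm q k ψ f x

/-- A matrix identity `α_x γ = γ' α_y` with `γ' ∈ Γ₀(M)` moves the slash action of `γ` through
that of `α_x`. -/
theorem slash_heckeMatrix_of_mul_eq (hf : HasNebentypus f M k ψ) {x y : OnePoint (ZMod q)}
    {γ γ' : SL(2, ℤ)} (hγ' : γ' ∈ CongruenceSubgroup.Gamma0 M)
    (h : heckeMatrixReal q x * mapGL ℝ γ = mapGL ℝ γ' * heckeMatrixReal q y) :
    (f ∣[k] heckeMatrixReal q x) ∣[k] γ =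
      ψ ((γ' 1 1 : ℤ) : ZMod M) • (f ∣[k] heckeMatrixReal q y) := by
  rw [ModularForm.SL_slash, ← SlashAction.slash_mul]
  change f ∣[k] (heckeMatrixReal q x * mapGL ℝ γ) = _
  rw [h, SlashAction.slash_mul]
  change (f ∣[k] γ') ∣[k] _ = _
  rw [hf γ' hγ', ModularForm.smul_slash, sigma_heckeMatrixReal]

/-- The action on the projective line over `ℤ/q` by which `γ` permutes the Hecke matrices: the
right action on row vectors. -/
noncomputable def heckePerm (q : ℕ) [Fact q.Prime] (γ : SL(2, ℤ)) : GL (Fin 2) (ZMod q) :=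
  GeneralLinearGroup.mkOfDetNeZero
    !![((γ 1 1 : ℤ) : ZMod q), ((γ 0 1 : ℤ) : ZMod q);
      ((γ 1 0 : ℤ) : ZMod q), ((γ 0 0 : ℤ) : ZMod q)] (by
    have h := γ.det_coe
    rw [det_fin_two] at h
    rw [det_fin_two_of]
    have h2 := congrArg (Int.cast : ℤ → ZMod q) h
    push_cast at h2
    rw [show ((γ 1 1 : ℤ) : ZMod q) * ((γ 0 0 : ℤ) : ZMod q) -
      ((γ 0 1 : ℤ) : ZMod q) * ((γ 1 0 : ℤ) : ZMod q) = 1 by rw [← h2]; ring]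
    exact one_ne_zero)

theorem heckePerm_coe (γ : SL(2, ℤ)) :
    (heckePerm q γ : Matrix (Fin 2) (Fin 2) (ZMod q)) =
      !![((γ 1 1 : ℤ) : ZMod q), ((γ 0 1 : ℤ) : ZMod q);
        ((γ 1 0 : ℤ) : ZMod q), ((γ 0 0 : ℤ) : ZMod q)] := rfl

/-- `Γ₀(M)` permutes the summands of the Hecke operator, up to the nebentypus. Unless
the term at `x` vanishes, the matrix `γ' = α_x γ α_y⁻¹`, with `y` the image of `x` under
`heckePerm q γ`, is integral and lies in `Γ₀(M)`. -/
theorem heckeTerm_slash (hf : HasNebentypus f M k ψ) {γ : SL(2, ℤ)}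
    (hγ : γ ∈ CongruenceSubgroup.Gamma0 M) (x : OnePoint (ZMod q)) :
    heckeTerm q k ψ f x ∣[k] γ =
      ψ ((γ 1 1 : ℤ) : ZMod M) • heckeTerm q k ψ f (heckePerm q γ • x) := by
  have hdet := γ.det_coe
  rw [det_fin_two] at hdet
  set a := γ 0 0 with ha
  set b := γ 0 1 with hb
  set c := γ 1 0 with hc
  set d := γ 1 1 with hd
  have hcM : (M : ℤ) ∣ c := by
    rw [← ZMod.intCast_zmod_eq_zero_iff_dvd]
    exact CongruenceSubgroup.Gamma0_mem.mp hγ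
  have hcM' : (c : ZMod M) = 0 := CongruenceSubgroup.Gamma0_mem.mp hγ
  have hqdvd : ∀ z : ℤ, ((z : ZMod q) = 0) → ∃ e, z = q * e := fun z hz =>
    (ZMod.intCast_zmod_eq_zero_iff_dvd z q).mp hz
  have hmap : ∀ g : SL(2, ℤ), (mapGL ℝ g : Matrix (Fin 2) (Fin 2) ℝ) =
      !![((g 0 0 : ℤ) : ℝ), ((g 0 1 : ℤ) : ℝ); ((g 1 0 : ℤ) : ℝ), ((g 1 1 : ℤ) : ℝ)] := by
    intro g
    ext i j
    fin_cases i <;> fin_cases j <;> simp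
  have hval : ∀ j : ZMod q, (((j.val : ℤ) : ZMod q)) = j := fun j => by simp
  have hdetR : (a : ℝ) * d - b * c = 1 := by exact_mod_cast hdet
  cases x with
  | coe j =>
    rw [heckeTerm_coe, OnePoint.smul_some_eq_ite, heckePerm_coe]
    simp only [of_apply, cons_val_zero, cons_val_one, cons_val', ← ha, ← hb, ← hc, ← hd]
    set J : ℤ := (j.val : ℤ) with hJ
    have hJR : ((j.val : ℕ) : ℝ) = (J : ℝ) := by simp [hJ]
    have hJq : j = (J : ZMod q) := (hval j).symm
    split_ifs with h0
    -- the point `j` is moved to infinity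
    · obtain ⟨e, he⟩ := hqdvd (c * J + a) (by push_cast; rw [← hJq]; exact h0)
      let γ' : SL(2, ℤ) := ⟨!![e, b + J * d; c, q * d], by
        rw [det_fin_two_of]; linear_combination hdet - d * he⟩
      have heR : (c : ℝ) * J + a = q * e := by exact_mod_cast he
      rw [slash_heckeMatrix_of_mul_eq (y := OnePoint.infty) (γ' := γ') hf]
      · simp [γ', heckeTerm_infty, smul_smul, mul_comm]
      · exact CongruenceSubgroup.Gamma0_mem.mpr (by simpa [γ'] using hcM')
      · apply Units.ext
        rw [GeneralLinearGroup.coe_mul, GeneralLinearGroup.coe_mul, hmap, hmap,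
          heckeMatrixReal_coe, heckeMatrixReal_infty, hJR]
        ext i l
        fin_cases i <;> fin_cases l <;> simp [γ', ← ha, ← hb, ← hc, ← hd] <;>
          first | ring1 | linear_combination heR
    · set j' : ZMod q := ((d : ZMod q) * j + b) / (c * j + a) with hj'
      set J' : ℤ := (j'.val : ℤ) with hJ'
      have hJR' : ((j'.val : ℕ) : ℝ) = (J' : ℝ) := by simp [hJ']
      have hJq' : j' = (J' : ZMod q) := (hval j').symm
      have hrel : (c * j + a) * j' = (d : ZMod q) * j + b := mul_div_cancel₀ _ h0
      obtain ⟨e, he⟩ := hqdvd (b + J * d - J' * (c * J + a)) (by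
        push_cast
        rw [← hJq, ← hJq']
        linear_combination -hrel)
      have heR : (b : ℝ) + J * d - J' * (c * J + a) = q * e := by exact_mod_cast he
      let γ' : SL(2, ℤ) := ⟨!![a + J * c, e; q * c, d - c * J'], by
        rw [det_fin_two_of]; linear_combination hdet + c * he⟩
      rw [slash_heckeMatrix_of_mul_eq (y := (j' : OnePoint (ZMod q))) (γ' := γ') hf]
      · simp [γ', hcM', heckeTerm_coe]
      · exact CongruenceSubgroup.Gamma0_mem.mpr (by simp [γ', hcM'])
      · apply Units.ext
        rw [GeneralLinearGroup.coe_mul, GeneralLinearGroup.coe_mul, hmap, hmap,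
          heckeMatrixReal_coe, heckeMatrixReal_coe, hJR, hJR']
        ext i l
        fin_cases i <;> fin_cases l <;> simp [γ', ← ha, ← hb, ← hc, ← hd] <;>
          first | ring1 | linear_combination heR
  | infty =>
    rw [heckeTerm_infty, ModularForm.SL_smul_slash]
    by_cases hqM : ψ (q : ZMod M) = 0
    -- if `q` divides `M`, then `γ` fixes the point at infinity, whose term vanishes
    · have h0 : (c : ZMod q) = 0 := by
        by_contra hne
        have hu : ¬ IsUnit (q : ZMod M) := fun hu => (hu.map ψ.toMonoidHom).ne_zero hqM
        rw [ZMod.isUnit_iff_coprime, Nat.Prime.coprime_iff_not_dvd Fact.out, not_not] at hu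
        exact hne ((ZMod.intCast_zmod_eq_zero_iff_dvd c q).mpr
          ((Int.natCast_dvd_natCast.mpr hu).trans hcM))
      rw [OnePoint.smul_infty_eq_ite, heckePerm_coe]
      simp [← hc, h0, heckeTerm_infty, hqM]
    · have hu : IsUnit (q : ZMod M) := by
        by_contra hu
        exact hqM (ψ.map_nonunit hu)
      have hcop : IsCoprime (M : ℤ) (q : ℤ) :=
        Nat.isCoprime_iff_coprime.mpr ((ZMod.isUnit_iff_coprime q M).mp hu).symm
      rw [OnePoint.smul_infty_eq_ite, heckePerm_coe]
      simp only [of_apply, cons_val_zero, cons_val_one, cons_val', ← ha, ← hb, ← hc, ← hd]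
      split_ifs with h0
      · obtain ⟨e, he⟩ := hqdvd c h0
        have heR : (c : ℝ) = q * e := by exact_mod_cast he
        have heM : (e : ZMod M) = 0 := by
          rw [ZMod.intCast_zmod_eq_zero_iff_dvd]
          exact hcop.dvd_of_dvd_mul_left (he ▸ hcM)
        let γ' : SL(2, ℤ) := ⟨!![a, q * b; e, d], by
          rw [det_fin_two_of]; linear_combination hdet + b * he⟩
        rw [slash_heckeMatrix_of_mul_eq (y := OnePoint.infty) (γ' := γ') hf]
        · simp [γ', heckeTerm_infty, smul_smul, mul_comm]
        · exact CongruenceSubgroup.Gamma0_mem.mpr (by simpa [γ'] using heM)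
        · apply Units.ext
          rw [GeneralLinearGroup.coe_mul, GeneralLinearGroup.coe_mul, hmap, hmap,
            heckeMatrixReal_infty]
          ext i l
          fin_cases i <;> fin_cases l <;> simp [γ', ← ha, ← hb, ← hc, ← hd] <;>
            first | ring1 | linear_combination heR
      · set j' : ZMod q := (d : ZMod q) / c with hj'
        set J' : ℤ := (j'.val : ℤ) with hJ'
        have hJR' : ((j'.val : ℕ) : ℝ) = (J' : ℝ) := by simp [hJ']
        have hJq' : j' = (J' : ZMod q) := (hval j').symm
        have hrel : c * j' = (d : ZMod q) := mul_div_cancel₀ _ h0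
        obtain ⟨e, he⟩ := hqdvd (d - c * J') (by
          push_cast
          rw [← hJq']
          linear_combination -hrel)
        have heR : (d : ℝ) - c * J' = q * e := by exact_mod_cast he
        have heM : (q : ZMod M) * e = d := by
          have := congrArg (Int.cast : ℤ → ZMod M) he
          push_cast at this
          rw [← this, hcM']
          ring
        let γ' : SL(2, ℤ) := ⟨!![q * a, b - J' * a; c, e], by
          rw [det_fin_two_of]; linear_combination hdet - a * he⟩
        rw [slash_heckeMatrix_of_mul_eq (y := (j' : OnePoint (ZMod q))) (γ' := γ') hf]
        · rw [← heM, map_mul, heckeTerm_coe, smul_smul]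
          simp [γ']
        · exact CongruenceSubgroup.Gamma0_mem.mpr (by simp [γ', hcM'])
        · apply Units.ext
          rw [GeneralLinearGroup.coe_mul, GeneralLinearGroup.coe_mul, hmap, hmap,
            heckeMatrixReal_coe, heckeMatrixReal_infty, hJR']
          ext i l
          fin_cases i <;> fin_cases l <;> simp [γ', ← ha, ← hb, ← hc, ← hd] <;>
            first | ring1 | linear_combination heR

theorem HasNebentypus.heckeFun (hf : HasNebentypus f M k ψ) :
    HasNebentypus (heckeFun q k ψ f) M k ψ := by
  intro γ hγ
  have h1 : LambdaAdic.heckeFun q k ψ f ∣[k] γ =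
      ∑ x : OnePoint (ZMod q), heckeTerm q k ψ f x ∣[k] γ := by
    rw [LambdaAdic.heckeFun, SlashAction.sum_slash]
  rw [h1, Finset.sum_congr rfl fun x _ => heckeTerm_slash hf hγ x, ← Finset.smul_sum]
  congr 1
  exact Equiv.sum_comp (MulAction.toPerm (heckePerm q γ)) (heckeTerm q k ψ f)

end ClassicalHecke

/-! ### Holomorphy, cusps and `q`-expansions of Hecke transforms -/

section HeckeExpansion

open Matrix Matrix.SpecialLinearGroup UpperHalfPlane

variable {q : ℕ} [Fact q.Prime] {M : ℕ} {k : ℤ} {ψ : DirichletCharacter ℂ M} {f : ℍ → ℂ}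

/-- `Γ₁(M)` as a subgroup of `GL₂(ℝ)`. -/
abbrev gammaOne (M : ℕ) : Subgroup (GL (Fin 2) ℝ) :=
  (CongruenceSubgroup.Gamma1 M).map (mapGL ℝ)

/-- A rational matrix maps cusps of an arithmetic group to cusps. -/
theorem isCusp_rat_smul {Γ : Subgroup (GL (Fin 2) ℝ)} [Γ.IsArithmetic] (A : GL (Fin 2) ℚ)
    {c : OnePoint ℝ} (hc : IsCusp c Γ) : IsCusp (A.map (Rat.castHom ℝ) • c) Γ := by
  rw [Subgroup.IsArithmetic.isCusp_iff_isCusp_SL2Z, isCusp_SL2Z_iff] at hc ⊢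
  obtain ⟨x, rfl⟩ := hc
  exact ⟨A • x, OnePoint.map_smul (Rat.castHom ℝ) A x⟩

theorem isBoundedAtImInfty_sum_smul {ι : Type*} (s : Finset ι) (g : ι → ℍ → ℂ) (c : ι → ℂ)
    (h : ∀ i, IsBoundedAtImInfty (g i)) : IsBoundedAtImInfty (∑ i ∈ s, c i • g i) := by
  classical
  induction s using Finset.induction_on with
  | empty => simpa using! Filter.const_boundedAtFilter atImInfty (0 : ℂ)
  | insert i s hi ih =>
    rw [Finset.sum_insert hi]
    exact Filter.BoundedAtFilter.add (Filter.BoundedAtFilter.smul (c i) (h i)) ih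

theorem isZeroAtImInfty_sum_smul {ι : Type*} (s : Finset ι) (g : ι → ℍ → ℂ) (c : ι → ℂ)
    (h : ∀ i, IsZeroAtImInfty (g i)) : IsZeroAtImInfty (∑ i ∈ s, c i • g i) := by
  classical
  induction s using Finset.induction_on with
  | empty => simpa using! Filter.zero_zeroAtFilter atImInfty (β := ℂ)
  | insert i s hi ih =>
    rw [Finset.sum_insert hi]
    exact Filter.ZeroAtFilter.add (Filter.ZeroAtFilter.smul (c i) (h i)) ih

theorem heckeFun_slash_eq_sum (g : GL (Fin 2) ℝ) :
    heckeFun q k ψ f ∣[k] g = ∑ x : OnePoint (ZMod q),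
      (σ g (x.elim (ψ (q : ZMod M)) fun _ => 1)) • ((f ∣[k] heckeMatrixReal q x) ∣[k] g) := by
  rw [heckeFun, SlashAction.sum_slash]
  refine Finset.sum_congr rfl fun x _ => ?_
  rw [heckeTerm, ModularForm.smul_slash]

theorem isBoundedAt_heckeFun [NeZero M] {c : OnePoint ℝ}
    (hf : ∀ c, IsCusp c (gammaOne M) → c.IsBoundedAt f k) (hc : IsCusp c (gammaOne M)) :
    c.IsBoundedAt (heckeFun q k ψ f) k := by
  intro g hg
  rw [heckeFun_slash_eq_sum]
  exact isBoundedAtImInfty_sum_smul _ _ _ fun x =>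
    OnePoint.IsBoundedAt.smul_iff.mp (hf _ (isCusp_rat_smul (heckeMatrix q x) hc)) g hg

theorem isZeroAt_heckeFun [NeZero M] {c : OnePoint ℝ}
    (hf : ∀ c, IsCusp c (gammaOne M) → c.IsZeroAt f k) (hc : IsCusp c (gammaOne M)) :
    c.IsZeroAt (heckeFun q k ψ f) k := by
  intro g hg
  rw [heckeFun_slash_eq_sum]
  exact isZeroAtImInfty_sum_smul _ _ _ fun x =>
    OnePoint.IsZeroAt.smul_iff.mp (hf _ (isCusp_rat_smul (heckeMatrix q x) hc)) g hg

theorem mdifferentiable_heckeFun (hf : MDiff f) : MDiff (heckeFun q k ψ f) := by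
  rw [heckeFun]
  refine MDifferentiable.sum fun x _ => ?_
  exact (hf.slash k (heckeMatrixReal q x)).const_smul _

theorem HasNebentypus.slash_eq_of_mem_gammaOne (hf : HasNebentypus f M k ψ)
    {g : GL (Fin 2) ℝ} (hg : g ∈ gammaOne M) : f ∣[k] g = f := by
  obtain ⟨γ, hγ, rfl⟩ := hg
  have h := hf γ (CongruenceSubgroup.Gamma1_in_Gamma0 M hγ)
  rw [((CongruenceSubgroup.Gamma1_mem M γ).mp hγ).2.1, map_one, one_smul] at h
  exact h

/-- The Hecke operator `∑ aₙ qⁿ ↦ ∑ (a_{nℓ} + c a_{n/ℓ}) qⁿ` on formal `q`-expansions, the second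
term being present only if `ℓ ∣ n`. -/
noncomputable def heckeSeries (R : Type*) [CommRing R] (ℓ : ℕ) (c : R) (F : R⟦X⟧) : R⟦X⟧ :=
  PowerSeries.mk fun n => PowerSeries.coeff (n * ℓ) F +
    if ℓ ∣ n then c * PowerSeries.coeff (n / ℓ) F else 0

theorem map_heckeSeries {R S : Type*} [CommRing R] [CommRing S] (φ : R →+* S) (ℓ : ℕ) (c : R)
    (F : R⟦X⟧) : PowerSeries.map φ (heckeSeries R ℓ c F) =
      heckeSeries S ℓ (φ c) (PowerSeries.map φ F) := by
  ext n
  by_cases h : ℓ ∣ n <;> simp [heckeSeries, h]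

theorem qParam_eq (z : ℂ) :
    Function.Periodic.qParam 1 z = Complex.exp (2 * Real.pi * Complex.I * z) := by
  simp [Function.Periodic.qParam]

theorem slash_heckeMatrixReal_coe (j : ZMod q) (τ : ℍ) :
    ∃ w : ℍ, (w : ℂ) = (τ + j.val) / q ∧
      (f ∣[k] heckeMatrixReal q (j : OnePoint (ZMod q))) τ = (q : ℂ)⁻¹ * f w := by
  have hq : (q : ℂ) ≠ 0 := by exact_mod_cast (Fact.out : q.Prime).ne_zero
  have hdet : ((heckeMatrixReal q (j : OnePoint (ZMod q))).det : ℝ) = q := det_heckeMatrixReal _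
  have hpos : 0 < ((heckeMatrixReal q (j : OnePoint (ZMod q))).det : ℝ) := by
    rw [hdet]; exact_mod_cast (Fact.out : q.Prime).pos
  have hden : denom (heckeMatrixReal q (j : OnePoint (ZMod q))) τ = q := by
    simp [denom, heckeMatrixReal_coe]
  refine ⟨heckeMatrixReal q (j : OnePoint (ZMod q)) • τ, ?_, ?_⟩
  · rw [coe_smul_of_det_pos hpos, hden]
    simp [num, heckeMatrixReal_coe, -ZMod.natCast_val]
  · rw [ModularForm.slash_apply, sigma_heckeMatrixReal, hdet, hden, Nat.abs_cast]
    rw [mul_assoc, Complex.ofReal_natCast, ← zpow_add₀ hq, mul_comm]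
    congr 1
    rw [show k - 1 + -k = -1 by ring, _root_.zpow_neg_one]

theorem slash_heckeMatrixReal_infty (τ : ℍ) :
    ∃ w : ℍ, (w : ℂ) = q * τ ∧
      (f ∣[k] heckeMatrixReal q OnePoint.infty) τ = (q : ℂ) ^ (k - 1) * f w := by
  have hdet : ((heckeMatrixReal q OnePoint.infty).det : ℝ) = q := det_heckeMatrixReal _
  have hpos : 0 < ((heckeMatrixReal q OnePoint.infty).det : ℝ) := by
    rw [hdet]; exact_mod_cast (Fact.out : q.Prime).pos
  have hden : denom (heckeMatrixReal q OnePoint.infty) τ = 1 := by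
    simp [denom, heckeMatrixReal_infty]
  refine ⟨heckeMatrixReal q OnePoint.infty • τ, ?_, ?_⟩
  · rw [coe_smul_of_det_pos hpos, hden]
    simp [num, heckeMatrixReal_infty]
  · rw [ModularForm.slash_apply, sigma_heckeMatrixReal, hdet, hden, Nat.abs_cast]
    simp [mul_comm]

/-- Averaging over the translates by `j/q` selects the exponents divisible by `q`. -/
theorem sum_qParam_translate (τ : ℂ) (n : ℕ) :
    ∑ j : ZMod q, (q : ℂ)⁻¹ * Function.Periodic.qParam 1 ((τ + j.val) / q) ^ n =
      if q ∣ n then Function.Periodic.qParam 1 τ ^ (n / q) else 0 := by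
  have hq : (q : ℂ) ≠ 0 := by exact_mod_cast (Fact.out : q.Prime).ne_zero
  have hterm : ∀ j : ZMod q, (q : ℂ)⁻¹ * Function.Periodic.qParam 1 ((τ + j.val) / q) ^ n =
      ((q : ℂ)⁻¹ * Complex.exp (2 * Real.pi * Complex.I * τ * n / q)) *
        ZMod.stdAddChar (j * (n : ZMod q)) := by
    intro j
    have h1 : j * (n : ZMod q) = (((j.val * n : ℕ) : ℤ) : ZMod q) := by simp
    rw [h1, ZMod.stdAddChar_coe, mul_assoc, ← Complex.exp_add, qParam_eq, ← Complex.exp_nat_mul]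
    congr 2
    push_cast
    field_simp
  rw [Finset.sum_congr rfl fun j _ => hterm j, ← Finset.mul_sum,
    AddChar.sum_mulShift _ (ZMod.isPrimitive_stdAddChar q), ZMod.card]
  simp only [ZMod.natCast_eq_zero_iff]
  split_ifs with h
  · obtain ⟨m, rfl⟩ := h
    rw [Nat.mul_div_cancel_left _ (Fact.out : q.Prime).pos, qParam_eq, ← Complex.exp_nat_mul,
      mul_right_comm, inv_mul_cancel₀ hq, one_mul]
    congr 1
    push_cast
    field_simp
  · simp

/-- The effect of the Hecke operator on Fourier expansions: the finite points of the projective line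
contribute the coefficients `a_{nq}`, the point at infinity the coefficients `a_{n/q}`. -/
theorem hasSum_heckeFun {a : ℕ → ℂ}
    (hf : ∀ τ : ℍ, HasSum (fun n => a n * Function.Periodic.qParam 1 τ ^ n) (f τ)) (τ : ℍ) :
    HasSum (fun n => (a (n * q) + if q ∣ n then ψ (q : ZMod M) * (q : ℂ) ^ (k - 1) * a (n / q)
      else 0) * Function.Periodic.qParam 1 τ ^ n) (heckeFun q k ψ f τ) := by
  have hqpos : 0 < q := (Fact.out : q.Prime).pos
  have hinj : Function.Injective fun n : ℕ => n * q := fun m n h =>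
    Nat.eq_of_mul_eq_mul_right hqpos h
  have hrange : ∀ n ∉ Set.range fun n : ℕ => n * q, ¬ q ∣ n := by
    rintro n hn ⟨m, rfl⟩
    exact hn ⟨m, mul_comm m q⟩
  have hfin : HasSum (fun n => a (n * q) * Function.Periodic.qParam 1 τ ^ n)
      (∑ j : ZMod q, (f ∣[k] heckeMatrixReal q (j : OnePoint (ZMod q))) τ) := by
    have h1 : HasSum (fun n => ∑ j : ZMod q, (q : ℂ)⁻¹ *
          (a n * Function.Periodic.qParam 1 ((τ + j.val) / q) ^ n))
        (∑ j : ZMod q, (f ∣[k] heckeMatrixReal q (j : OnePoint (ZMod q))) τ) := by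
      refine hasSum_sum fun j _ => ?_
      obtain ⟨w, hw, h⟩ := slash_heckeMatrixReal_coe (f := f) (k := k) j τ
      rw [h, ← hw]
      exact (hf w).mul_left _
    have h2 : ∀ n, ∑ j : ZMod q, (q : ℂ)⁻¹ *
          (a n * Function.Periodic.qParam 1 ((τ + j.val) / q) ^ n) =
        a n * if q ∣ n then Function.Periodic.qParam 1 τ ^ (n / q) else 0 := by
      intro n
      rw [← sum_qParam_translate, Finset.mul_sum]
      exact Finset.sum_congr rfl fun j _ => by ring
    simp only [h2] at h1
    rw [← hinj.hasSum_iff fun n hn => by rw [if_neg (hrange n hn), mul_zero]] at h1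
    refine Eq.subst (motive := fun u => HasSum u _) (funext fun n => ?_) h1
    simp [Nat.mul_div_cancel _ hqpos]
  have hinf : HasSum (fun n => (if q ∣ n then ψ (q : ZMod M) * (q : ℂ) ^ (k - 1) * a (n / q)
      else 0) * Function.Periodic.qParam 1 τ ^ n) (heckeTerm q k ψ f OnePoint.infty τ) := by
    obtain ⟨w, hw, h⟩ := slash_heckeMatrixReal_infty (q := q) (f := f) (k := k) τ
    rw [heckeTerm_infty, Pi.smul_apply, h, smul_eq_mul, ← mul_assoc,
      ← hinj.hasSum_iff fun n hn => by rw [if_neg (hrange n hn), zero_mul]]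
    refine Eq.subst (motive := fun u => HasSum u _) (funext fun n => ?_) ((hf w).mul_left _)
    have hz : Function.Periodic.qParam 1 (w : ℂ) = Function.Periodic.qParam 1 τ ^ q := by
      rw [hw, qParam_eq, qParam_eq, ← Complex.exp_nat_mul]
      congr 1
      ring
    simp [Nat.mul_div_cancel _ hqpos, hz, ← pow_mul, Nat.mul_comm q n, mul_assoc]
  have hsum : heckeFun q k ψ f τ =
      (∑ j : ZMod q, (f ∣[k] heckeMatrixReal q (j : OnePoint (ZMod q))) τ) +
        heckeTerm q k ψ f OnePoint.infty τ := by
    rw [heckeFun, Finset.sum_apply, add_comm]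
    refine (Fintype.sum_option (fun x : Option (ZMod q) => heckeTerm q k ψ f x τ)).trans ?_
    congr 1
    refine Finset.sum_congr rfl fun j _ => ?_
    exact congrFun (heckeTerm_coe j) τ
  rw [hsum]
  simpa only [add_mul] using hfin.add hinf

theorem IsClassicalQExpansion.heckeSeries [NeZero M] {κ : FormKind} {k : ℕ} {F : ℂ⟦X⟧}
    (h : IsClassicalQExpansion κ M k ψ F) :
    IsClassicalQExpansion κ M k ψ
      (heckeSeries ℂ q (ψ (q : ZMod M) * (q : ℂ) ^ ((k : ℤ) - 1)) F) := by
  cases κ with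
  | modular =>
    obtain ⟨f, hf, rfl⟩ := h
    have hN : HasNebentypus (heckeFun q k ψ f) M k ψ := HasNebentypus.heckeFun hf
    let g : ModularForm (gammaOne M) (k : ℤ) :=
      { toFun := heckeFun q k ψ f
        slash_action_eq' := fun γ hγ => hN.slash_eq_of_mem_gammaOne hγ
        holo' := mdifferentiable_heckeFun f.holo'
        bdd_at_cusps' := fun hc =>
          isBoundedAt_heckeFun (fun c hc => f.bdd_at_cusps' hc) hc }
    refine ⟨g, hN, ?_⟩
    ext n
    rw [LambdaAdic.heckeSeries, PowerSeries.coeff_mk]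
    exact (ModularFormClass.qExpansion_coeff_unique one_pos (by simp) (f := g) (hasSum_heckeFun
      (fun τ => ModularForm.hasSum_qExpansion f one_pos (by simp) τ)) n).symm
  | cuspidal =>
    obtain ⟨f, hf, rfl⟩ := h
    have hN : HasNebentypus (heckeFun q k ψ f) M k ψ := HasNebentypus.heckeFun hf
    let g : CuspForm (gammaOne M) (k : ℤ) :=
      { toFun := heckeFun q k ψ f
        slash_action_eq' := fun γ hγ => hN.slash_eq_of_mem_gammaOne hγ
        holo' := mdifferentiable_heckeFun f.holo'
        zero_at_cusps' := fun hc =>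
          isZeroAt_heckeFun (fun c hc => f.zero_at_cusps' hc) hc }
    refine ⟨g, hN, ?_⟩
    ext n
    rw [LambdaAdic.heckeSeries, PowerSeries.coeff_mk]
    exact (ModularFormClass.qExpansion_coeff_unique one_pos (by simp) (f := g) (hasSum_heckeFun
      (fun τ => ModularForm.hasSum_qExpansion f one_pos (by simp) τ)) n).symm

end HeckeExpansion

/-! ### Stability of the spaces of classical forms under Hecke operators -/

section Stability

variable {p : ℕ} [Fact p.Prime] {ιp : AlgebraicClosure ℚ →+* PadicAlgCl p}
  {ιinf : AlgebraicClosure ℚ →+* ℂ} {κ : FormKind} {M k : ℕ}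

theorem heckeSeries_zero_eq_heckeU {R : Type*} [CommRing R] (ℓ : ℕ) (F : R⟦X⟧) :
    heckeSeries R ℓ 0 F = heckeU ℓ R F := by
  ext n
  simp [heckeSeries, heckeU]

theorem heckeSeries_add {R : Type*} [CommRing R] (ℓ : ℕ) (c : R) (F G : R⟦X⟧) :
    heckeSeries R ℓ c (F + G) = heckeSeries R ℓ c F + heckeSeries R ℓ c G := by
  ext n
  by_cases h : ℓ ∣ n
  · simp [heckeSeries, h]; ring
  · simp [heckeSeries, h]

theorem heckeSeries_smul {R : Type*} [CommRing R] (ℓ : ℕ) (c r : R) (F : R⟦X⟧) :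
    heckeSeries R ℓ c (r • F) = r • heckeSeries R ℓ c F := by
  ext n
  by_cases h : ℓ ∣ n
  · simp [heckeSeries, h]; ring
  · simp [heckeSeries, h]

theorem heckeSeries_mem_classicalForms [NeZero M] {ℓ : ℕ} (hℓ : ℓ.Prime)
    {ψ : DirichletCharacter ℂ_[p] M} {F : ℂ_[p]⟦X⟧}
    (hF : F ∈ classicalForms p ιp ιinf κ M k ψ) :
    heckeSeries ℂ_[p] ℓ (ψ (ℓ : ZMod M) * (ℓ : ℂ_[p]) ^ ((k : ℤ) - 1)) F ∈
      classicalForms p ιp ιinf κ M k ψ := by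
  have : Fact ℓ.Prime := ⟨hℓ⟩
  induction hF using Submodule.span_induction with
  | mem F hF =>
    obtain ⟨ψ₀, A, hψ, hA, rfl⟩ := hF
    refine Submodule.subset_span ⟨ψ₀,
      heckeSeries _ ℓ (ψ₀ (ℓ : ZMod M) * (ℓ : AlgebraicClosure ℚ) ^ ((k : ℤ) - 1)) A, hψ, ?_, ?_⟩
    · rw [map_heckeSeries]
      have := hA.heckeSeries (q := ℓ)
      simpa using this
    · rw [map_heckeSeries, ← hψ]
      simp
  | zero =>
    have : heckeSeries ℂ_[p] ℓ (ψ (ℓ : ZMod M) * (ℓ : ℂ_[p]) ^ ((k : ℤ) - 1)) 0 = 0 := by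
      ext n
      simp [heckeSeries]
    rw [this]
    exact zero_mem _
  | add F G _ _ h1 h2 => rw [heckeSeries_add]; exact add_mem h1 h2
  | smul r F _ h => rw [heckeSeries_smul]; exact Submodule.smul_mem _ _ h

theorem heckeU_mem_classicalForms [NeZero M] (hpM : p ∣ M)
    {ψ : DirichletCharacter ℂ_[p] M} {F : ℂ_[p]⟦X⟧}
    (hF : F ∈ classicalForms p ιp ιinf κ M k ψ) :
    heckeU p ℂ_[p] F ∈ classicalForms p ιp ιinf κ M k ψ := by
  have h := heckeSeries_mem_classicalForms (Fact.out : p.Prime) hF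
  -- `U_p` is the Hecke operator at `p`, as `ψ` vanishes at the divisors of its modulus
  have h0 : ψ (p : ZMod M) = 0 := by
    apply ψ.map_nonunit
    rw [ZMod.isUnit_iff_coprime, Nat.Prime.coprime_iff_not_dvd Fact.out, not_not]
    exact hpM
  rwa [h0, zero_mul, heckeSeries_zero_eq_heckeU] at h

theorem heckeU_pow_mem_classicalForms [NeZero M] (hpM : p ∣ M)
    {ψ : DirichletCharacter ℂ_[p] M} (n : ℕ) {F : ℂ_[p]⟦X⟧}
    (hF : F ∈ classicalForms p ιp ιinf κ M k ψ) :
    (heckeU p ℂ_[p] ^ n) F ∈ classicalForms p ιp ιinf κ M k ψ :=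
  pow_mem_of_map_le (fun _ => heckeU_mem_classicalForms hpM) n hF

end Stability

/-! ### Finitely many coefficients determine a classical form -/

section Sturm

open Matrix Matrix.SpecialLinearGroup UpperHalfPlane SlashInvariantForm

/-- A modular form for `Γ₁(M)` vanishes if sufficiently many of its Fourier coefficients do. Its
norm to level one is `f * G` with `G` holomorphic, bounded and `1`-periodic, so the order of
vanishing of the norm at infinity is at least that of `f`, and the bound in level one applies. -/
theorem exists_sturm_bound (M : ℕ) [NeZero M] (k : ℤ) :
    ∃ B : ℕ, ∀ f : ModularForm (gammaOne M) k,
      (∀ n < B, PowerSeries.coeff n (qExpansion 1 f) = 0) → f = 0 := by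
  classical
  let Q := 𝒮ℒ ⧸ (gammaOne M).subgroupOf 𝒮ℒ
  let : Fintype Q := Fintype.ofFinite Q
  refine ⟨(k * Nat.card Q).toNat / 12 + 1, fun f hf => ?_⟩
  have hQ : (gammaOne M).IsFiniteRelIndex 𝒮ℒ := inferInstance
  let one : Q := QuotientGroup.mk 1
  -- the factor of the norm complementary to `f`
  let G : ℍ → ℂ := ∏ x ∈ Finset.univ.erase one, quotientFunc f x
  have hnorm : (ModularForm.norm 𝒮ℒ f : ℍ → ℂ) = f * G := by
    have h1 : (ModularForm.norm 𝒮ℒ f : ℍ → ℂ) = ∏ x : Q, quotientFunc f x := by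
      rw [ModularForm.coe_norm]
    rw [h1, ← Finset.mul_prod_erase _ _ (Finset.mem_univ one)]
    congr 1
    change quotientFunc f ⟦1⟧ = _
    rw [quotientFunc_mk]
    simp
  have hQholo : ∀ x : Q, MDiff (quotientFunc f x) :=
    Quotient.forall.mpr fun r => (ModularForm.translate f r.val⁻¹).holo'
  have hGholo : MDiff G := MDifferentiable.prod fun x _ => hQholo x
  have hQbdd : ∀ x : Q, IsBoundedAtImInfty (quotientFunc f x) := by
    refine Quotient.forall.mpr ?_
    rintro ⟨_, γ, rfl⟩
    rw [quotientFunc_mk]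
    have h := ModularFormClass.bdd_at_infty_slash f γ⁻¹
    rwa [ModularForm.SL_slash, map_inv] at h
  have hGbdd : IsBoundedAtImInfty G := by
    have : ∀ s : Finset Q, IsBoundedAtImInfty (∏ x ∈ s, quotientFunc f x) := by
      intro s
      induction s using Finset.induction_on with
      | empty => simpa using! Filter.const_boundedAtFilter atImInfty (1 : ℂ)
      | insert i s hi ih =>
        rw [Finset.prod_insert hi]
        exact Filter.BoundedAtFilter.mul (hQbdd i) ih
    exact this _
  have hGT : ∀ τ : ℍ, G ((1 : ℝ) +ᵥ τ) = G τ := by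
    intro τ
    have hT : (mapGL ℝ ModularGroup.T : GL (Fin 2) ℝ) ∈ 𝒮ℒ := ⟨_, rfl⟩
    have hslash : ∀ x : Q, quotientFunc f x ((1 : ℝ) +ᵥ τ) =
        quotientFunc f ((⟨_, hT⟩ : 𝒮ℒ)⁻¹ • x) τ := by
      intro x
      rw [← quotientFunc_smul f hT x]
      change _ = (quotientFunc f x ∣[k] ModularGroup.T) τ
      rw [ModularForm.SL_slash_apply, UpperHalfPlane.modular_T_smul, ModularGroup.denom_apply]
      simp [ModularGroup.T]
    have hone : (⟨_, hT⟩ : 𝒮ℒ)⁻¹ • one = one := by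
      change (QuotientGroup.mk ((⟨_, hT⟩ : 𝒮ℒ)⁻¹ * 1) : Q) = QuotientGroup.mk 1
      rw [QuotientGroup.eq, mul_one, mul_one, inv_inv, Subgroup.mem_subgroupOf]
      exact ⟨ModularGroup.T,
        (CongruenceSubgroup.Gamma1_mem M _).mpr (by simp [ModularGroup.T]), rfl⟩
    simp only [G, Finset.prod_apply]
    rw [Finset.prod_congr rfl fun x _ => hslash x]
    refine Finset.prod_equiv (MulAction.toPerm (⟨_, hT⟩ : 𝒮ℒ)⁻¹) (fun x => ?_) fun x _ => rfl
    simp only [Finset.mem_erase, Finset.mem_univ, and_true, MulAction.toPerm_apply]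
    rw [not_iff_not]
    constructor
    · rintro rfl
      exact hone
    · intro h
      exact smul_left_cancel _ (h.trans hone.symm)
  have hGper : Function.Periodic (G ∘ ofComplex) (1 : ℝ) := by
    intro w
    by_cases hw : 0 < w.im
    · have h1 : 0 < (w + (1 : ℝ)).im := by simpa using hw
      simp only [Function.comp_apply, ofComplex_apply_of_im_pos h1, ofComplex_apply_of_im_pos hw]
      rw [← hGT ⟨w, hw⟩]
      congr 1
      ext
      simp [add_comm]
    · have h1 : (w + (1 : ℝ)).im ≤ 0 := by simpa using hw
      simp only [Function.comp_apply, ofComplex_apply_of_im_nonpos h1,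
        ofComplex_apply_of_im_nonpos (not_lt.mp hw)]
  have hGan : AnalyticAt ℂ (cuspFunction 1 G) 0 :=
    UpperHalfPlane.analyticAt_cuspFunction_zero one_pos hGper hGholo hGbdd
  have hfan : AnalyticAt ℂ (cuspFunction 1 f) 0 :=
    ModularFormClass.analyticAt_cuspFunction_zero f one_pos (by simp)
  have hq : qExpansion 1 (ModularForm.norm 𝒮ℒ f) = qExpansion 1 f * qExpansion 1 G := by
    rw [hnorm, UpperHalfPlane.qExpansion_mul hfan hGan]
  have hzero : ModularForm.norm 𝒮ℒ f = 0 := by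
    apply ModularForm.sturm_bound_levelOne
    rw [hq, PowerSeries.order_mul]
    refine lt_of_lt_of_le ?_ le_self_add
    refine lt_of_lt_of_le ?_ (PowerSeries.nat_le_order _ _ fun i hi => hf i hi)
    exact_mod_cast Nat.lt_succ_self _
  rw [ModularForm.norm_eq_zero_iff] at hzero
  ext τ
  exact congrFun hzero τ

end Sturm

/-! ### Coefficientwise limits of classical forms -/

section Coefficients

open UpperHalfPlane

/-- The algebraic power series whose complex realization is the `q`-expansion of a modular form
for `Γ₁(M)`. -/
noncomputable def algebraicForms (ιinf : AlgebraicClosure ℚ →+* ℂ) (M k : ℕ) [NeZero M] :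
    Submodule (AlgebraicClosure ℚ) (AlgebraicClosure ℚ)⟦X⟧ :=
  { carrier := {A | ∃ f : ModularForm (gammaOne M) (k : ℤ),
      qExpansion 1 f = PowerSeries.map ιinf A}
    add_mem' := by
      rintro A B ⟨f, hf⟩ ⟨g, hg⟩
      refine ⟨f + g, ?_⟩
      rw [map_add, ← hf, ← hg, FunLike.coe_add, ModularForm.qExpansion_add one_pos (by simp)]
    zero_mem' := ⟨0, by rw [map_zero, FunLike.coe_zero, qExpansion_zero]⟩
    smul_mem' := by
      rintro c A ⟨f, hf⟩
      refine ⟨ιinf c • f, ?_⟩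
      rw [FunLike.coe_smul, ModularForm.qExpansion_smul one_pos (by simp), hf]
      ext n
      simp }

theorem mem_algebraicForms {ιinf : AlgebraicClosure ℚ →+* ℂ} {M k : ℕ} [NeZero M] {κ : FormKind}
    {ψ : DirichletCharacter ℂ M} {A : (AlgebraicClosure ℚ)⟦X⟧}
    (h : IsClassicalQExpansion κ M k ψ (PowerSeries.map ιinf A)) :
    A ∈ algebraicForms ιinf M k := by
  cases κ with
  | modular =>
    obtain ⟨f, -, hf⟩ := h
    exact ⟨f, hf⟩
  | cuspidal =>
    obtain ⟨f, -, hf⟩ := h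
    exact ⟨ModularFormClass.modularForm f, hf⟩

/-- If the first `B` coefficients determine the elements of a space of power series, then every
coefficient is a fixed linear combination of the first `B` ones. -/
theorem exists_coeff_eq_sum {K : Type*} [Field K] (W : Submodule K K⟦X⟧) (B : ℕ)
    (hW : ∀ A ∈ W, (∀ n < B, PowerSeries.coeff n A = 0) → A = 0) :
    ∃ s : ℕ → Fin B → K, ∀ A ∈ W, ∀ n,
      PowerSeries.coeff n A = ∑ i : Fin B, s n i * PowerSeries.coeff (i : ℕ) A := by
  let T : W →ₗ[K] (Fin B → K) :=
    (LinearMap.pi fun i : Fin B => PowerSeries.coeff (R := K) (i : ℕ)).comp W.subtype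
  have hT : LinearMap.ker T = ⊥ := by
    rw [LinearMap.ker_eq_bot']
    rintro ⟨A, hA⟩ h
    ext1
    exact hW A hA fun n hn => congrFun h ⟨n, hn⟩
  obtain ⟨S, hS⟩ := T.exists_leftInverse_of_injective hT
  refine ⟨fun n i => PowerSeries.coeff n
    (S fun j => if i = j then 1 else 0 : K⟦X⟧), fun A hA n => ?_⟩
  have h1 : S (T ⟨A, hA⟩) = ⟨A, hA⟩ := LinearMap.congr_fun hS _
  have h2 := LinearMap.pi_apply_eq_sum_univ S (T ⟨A, hA⟩)
  rw [h1] at h2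
  have h3 := congrArg (fun w : W => PowerSeries.coeff n (w : K⟦X⟧)) h2
  simp only [Submodule.coe_sum, Submodule.coe_smul, map_sum] at h3
  rw [h3]
  refine Finset.sum_congr rfl fun i _ => ?_
  rw [PowerSeries.coeff_smul, smul_eq_mul, mul_comm]
  rfl

variable {p : ℕ} [Fact p.Prime]

/-- All coefficients of a classical form are linear combinations, with fixed scalars, of finitely
many of them. -/
theorem exists_coeff_classicalForms (ιp : AlgebraicClosure ℚ →+* PadicAlgCl p)
    (ιinf : AlgebraicClosure ℚ →+* ℂ) (κ : FormKind) (M k : ℕ) [NeZero M]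
    (ψ : DirichletCharacter ℂ_[p] M) :
    ∃ (B : ℕ) (s : ℕ → Fin B → ℂ_[p]), ∀ F ∈ classicalForms p ιp ιinf κ M k ψ, ∀ n,
      PowerSeries.coeff n F = ∑ i : Fin B, s n i * PowerSeries.coeff (i : ℕ) F := by
  obtain ⟨B, hB⟩ := exists_sturm_bound M (k : ℤ)
  obtain ⟨s, hs⟩ := exists_coeff_eq_sum (algebraicForms ιinf M k) B (by
    rintro A ⟨f, hf⟩ hA
    have h0 : f = 0 := hB f fun n hn => by rw [hf, PowerSeries.coeff_map, hA n hn, map_zero]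
    rw [h0, FunLike.coe_zero, qExpansion_zero] at hf
    ext n
    have := congrArg (PowerSeries.coeff n) hf
    rw [PowerSeries.coeff_map, map_zero] at this
    simpa using this.symm)
  set j := (algebraMap (PadicAlgCl p) ℂ_[p]).comp ιp with hj
  refine ⟨B, fun n i => j (s n i), fun F hF n => ?_⟩
  induction hF using Submodule.span_induction with
  | mem F hF =>
    obtain ⟨ψ₀, A, -, hA, rfl⟩ := hF
    rw [PowerSeries.coeff_map, hs A (mem_algebraicForms hA) n, map_sum]
    exact Finset.sum_congr rfl fun i _ => by rw [map_mul, PowerSeries.coeff_map]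
  | zero => simp
  | add F G _ _ h1 h2 =>
    rw [map_add, h1, h2, ← Finset.sum_add_distrib]
    exact Finset.sum_congr rfl fun i _ => by rw [map_add, mul_add]
  | smul r F _ h =>
    rw [PowerSeries.coeff_smul, h, smul_eq_mul, Finset.mul_sum]
    exact Finset.sum_congr rfl fun i _ => by rw [PowerSeries.coeff_smul, smul_eq_mul, mul_left_comm]

/-- A coefficientwise limit of classical forms is a classical form: finite-dimensional subspaces are
closed, and the linear relations that express all coefficients in terms of the first ones pass to
the limit. -/
theorem mem_classicalForms_of_tendsto {ιp : AlgebraicClosure ℚ →+* PadicAlgCl p}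
    {ιinf : AlgebraicClosure ℚ →+* ℂ} {κ : FormKind} {M k : ℕ} [NeZero M]
    {ψ : DirichletCharacter ℂ_[p] M} {u : ℕ → ℂ_[p]⟦X⟧} {G : ℂ_[p]⟦X⟧}
    (hu : ∀ n, u n ∈ classicalForms p ιp ιinf κ M k ψ)
    (hG : ∀ i, Filter.Tendsto (fun n => PowerSeries.coeff i (u n)) Filter.atTop
      (nhds (PowerSeries.coeff i G))) :
    G ∈ classicalForms p ιp ιinf κ M k ψ := by
  obtain ⟨B, s, hs⟩ := exists_coeff_classicalForms ιp ιinf κ M k ψ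
  let T : ℂ_[p]⟦X⟧ →ₗ[ℂ_[p]] (Fin B → ℂ_[p]) :=
    LinearMap.pi fun i : Fin B => PowerSeries.coeff (R := ℂ_[p]) (i : ℕ)
  let V := (classicalForms p ιp ιinf κ M k ψ).map T
  have hclosed : IsClosed (V : Set (Fin B → ℂ_[p])) := Submodule.closed_of_finiteDimensional V
  have hmem : T G ∈ V := by
    refine hclosed.mem_of_tendsto (tendsto_pi_nhds.mpr fun i => hG i)
      (Filter.Eventually.of_forall fun n => ?_)
    exact Submodule.mem_map_of_mem (f := T) (hu n)
  obtain ⟨F, hF, hFG⟩ := hmem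
  have hrel : ∀ n, PowerSeries.coeff n G = ∑ i : Fin B, s n i * PowerSeries.coeff (i : ℕ) G := by
    intro n
    refine tendsto_nhds_unique (hG n) ?_
    simp only [hs _ (hu _) n]
    exact tendsto_finsetSum _ fun i _ => (hG i).const_mul _
  have : F = G := by
    ext n
    rw [hs F hF n, hrel n]
    exact Finset.sum_congr rfl fun i _ => by
      rw [show PowerSeries.coeff (i : ℕ) F = PowerSeries.coeff (i : ℕ) G from congrFun hFG i]
  exact this ▸ hF

end Coefficients

/-! ### The coefficient ring -/

section CoefficientRing

open IsLocalRing

theorem coeff_mem_of_mem_smul_top {R : Type*} [CommRing R] {I : Ideal R} {ξ : R⟦X⟧}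
    (h : ξ ∈ (I • ⊤ : Submodule R R⟦X⟧)) (n : ℕ) : PowerSeries.coeff n ξ ∈ I := by
  induction h using Submodule.smul_induction_on' with
  | smul r hr x _ =>
    rw [PowerSeries.coeff_smul]
    exact I.mul_mem_right _ hr
  | add x _ y _ hx hy =>
    rw [map_add]
    exact I.add_mem hx hy

/-- For a finitely generated ideal `I`, the submodule `I R⟦q⟧` consists of the power series with
coefficients in `I`. -/
theorem mem_smul_top_iff_coeff {R : Type*} [CommRing R] [IsNoetherianRing R] {I : Ideal R}
    {ξ : R⟦X⟧} : ξ ∈ (I • ⊤ : Submodule R R⟦X⟧) ↔ ∀ n, PowerSeries.coeff n ξ ∈ I := by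
  refine ⟨fun h n => coeff_mem_of_mem_smul_top h n, fun h => ?_⟩
  obtain ⟨m, g, hg⟩ := Submodule.fg_iff_exists_fin_generating_family.mp (IsNoetherian.noetherian I)
  have h' : ∀ n, ∃ c : Fin m → R, ∑ i, c i • g i = PowerSeries.coeff n ξ := fun n => by
    have := h n
    rw [← hg] at this
    exact (Submodule.mem_span_range_iff_exists_fun R).mp this
  choose c hc using h'
  have : ξ = ∑ i, g i • PowerSeries.mk fun n => c n i := by
    ext n
    rw [← hc n, map_sum]
    exact Finset.sum_congr rfl fun i _ => by
      rw [PowerSeries.coeff_smul, PowerSeries.coeff_mk, smul_eq_mul, smul_eq_mul, mul_comm]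
  rw [this]
  refine sum_mem fun i _ => Submodule.smul_mem_smul ?_ Submodule.mem_top
  rw [← hg]
  exact Submodule.subset_span ⟨i, rfl⟩

variable {p : ℕ} [Fact p.Prime] {L : IntermediateField ℚ_[p] (PadicAlgCl p)}
  {R : Type*} [CommRing R] [IsLocalRing R] [Algebra (Iw p L) R]

variable (p L R) in
theorem natCast_mem_maximalIdeal [IsLocalHom (algebraMap (Iw p L) R)] :
    (p : R) ∈ maximalIdeal R := by
  rw [mem_maximalIdeal, mem_nonunits_iff]
  intro h
  have h1 : IsUnit (p : Iw p L) :=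
    isUnit_of_map_unit (algebraMap (Iw p L) R) _ (by rwa [map_natCast])
  have h2 : IsUnit (p : IntRing p L) := by
    have := h1.map (PowerSeries.constantCoeff (R := IntRing p L))
    rwa [map_natCast] at this
  obtain ⟨u, hu⟩ := h2
  -- the inverse of `p` would be integral over `ℤ_p`
  have h3 : IsIntegral ℤ_[p] (algebraMap ℚ_[p] L ((p : ℚ_[p])⁻¹)) := by
    have h4 := (u⁻¹ : (IntRing p L)ˣ).1.2
    have h5 : (((u⁻¹ : (IntRing p L)ˣ) : IntRing p L) : L) =
        algebraMap ℚ_[p] L ((p : ℚ_[p])⁻¹) := by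
      have h6 : (((u⁻¹ : (IntRing p L)ˣ) : IntRing p L) : L) * (p : L) = 1 := by
        have := congrArg (fun x : IntRing p L => (x : L)) (u.inv_mul)
        rw [hu] at this
        simpa using this
      rw [map_inv₀, map_natCast]
      exact eq_inv_of_mul_eq_one_left h6
    rw [← h5]
    exact h4
  rw [isIntegral_algebraMap_iff (algebraMap ℚ_[p] L).injective] at h3
  obtain ⟨y, hy⟩ := IsIntegrallyClosed.isIntegral_iff.mp h3
  have h7 : ‖((p : ℚ_[p])⁻¹)‖ ≤ 1 := by
    rw [← hy]
    exact PadicInt.norm_le_one y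
  rw [norm_inv, Padic.norm_p, inv_inv] at h7
  have := (Fact.out : p.Prime).one_lt
  exact absurd h7 (not_le.mpr (by exact_mod_cast this))

/-- The residue field of `R` is a quotient of `𝒪_L / p`, hence finite. -/
theorem finite_residueField [FiniteDimensional ℚ_[p] L] [IsLocalHom (algebraMap (Iw p L) R)]
    (hres : ∀ x : R, ∃ a : IntRing p L,
      x - algebraMap (Iw p L) R (PowerSeries.C a) ∈ maximalIdeal R) :
    Finite (R ⧸ maximalIdeal R) := by
  let f : IntRing p L →+* R ⧸ maximalIdeal R :=
    (Ideal.Quotient.mk _).comp ((algebraMap (Iw p L) R).comp PowerSeries.C)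
  have hf : Function.Surjective f := by
    intro y
    obtain ⟨x, rfl⟩ := Ideal.Quotient.mk_surjective y
    obtain ⟨a, ha⟩ := hres x
    exact ⟨a, (Ideal.Quotient.eq.mpr ha).symm⟩
  have hfin : Module.Finite ℤ_[p] (IntRing p L) := IsIntegralClosure.finite ℤ_[p] ℚ_[p] L _
  obtain ⟨m, g, hg⟩ := Module.Finite.exists_fin (R := ℤ_[p]) (M := IntRing p L)
  -- every residue class is an integral combination of the `g i` with coefficients below `p`
  let F : (Fin m → Fin p) → R ⧸ maximalIdeal R := fun c =>
    ∑ i, ((c i : ℕ) : R ⧸ maximalIdeal R) * f (g i)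
  refine Finite.of_surjective F fun y => ?_
  obtain ⟨a, rfl⟩ := hf y
  have ha : a ∈ Submodule.span ℤ_[p] (Set.range g) := by rw [hg]; trivial
  obtain ⟨c, rfl⟩ := (Submodule.mem_span_range_iff_exists_fun ℤ_[p]).mp ha
  refine ⟨fun i => ⟨(c i).zmodRepr, PadicInt.zmodRepr_lt_p _⟩, ?_⟩
  simp only [F, map_sum]
  refine Finset.sum_congr rfl fun i _ => ?_
  have h1 := PadicInt.sub_zmodRepr_mem (c i)
  rw [PadicInt.maximalIdeal_eq_span_p, Ideal.mem_span_singleton] at h1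
  obtain ⟨d, hd⟩ := h1
  have h2 : c i = (c i).zmodRepr + p * d := by rw [← hd]; ring
  have h3 : f (p : IntRing p L) = 0 := by
    rw [map_natCast, ← map_natCast (Ideal.Quotient.mk (maximalIdeal R))]
    exact Ideal.Quotient.eq_zero_iff_mem.mpr (natCast_mem_maximalIdeal p L R)
  conv_rhs => rw [h2, Algebra.smul_def, map_mul, map_add, map_natCast, map_mul, map_natCast,
    map_add, map_mul, h3, map_natCast, zero_mul, add_zero]

theorem finite_quotient_maximalIdeal_pow [IsNoetherianRing R]
    (h : Finite (R ⧸ maximalIdeal R)) (n : ℕ) : Finite (R ⧸ maximalIdeal R ^ n) :=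
  Ideal.finite_quotient_pow (IsNoetherian.noetherian _) n

/-- A complete noetherian local ring with finite residue field is compact. -/
theorem compactSpace_adic [IsNoetherianRing R] [IsAdicComplete (maximalIdeal R) R]
    (h : Finite (R ⧸ maximalIdeal R)) :
    @CompactSpace R (maximalIdeal R).adicTopology := by
  let : WithIdeal R := ⟨maximalIdeal R⟩
  have hc := (IsAdic.isAdicComplete_iff (R := R) (I := maximalIdeal R) rfl).mp inferInstance
  obtain ⟨hc1, hc2⟩ := hc
  refine ⟨isCompact_iff_totallyBounded_isComplete.mpr
    ⟨?_, completeSpace_iff_isComplete_univ.mp hc1⟩⟩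
  rw [totallyBounded_iff_subset_finite_iUnion_nhds_zero]
  intro U hU
  obtain ⟨n, -, hn⟩ := (Ideal.hasBasis_nhds_zero_adic (maximalIdeal R)).mem_iff.mp hU
  have hfin := finite_quotient_maximalIdeal_pow h n
  refine ⟨Set.range (Quotient.out : R ⧸ maximalIdeal R ^ n → R), Set.finite_range _, fun x _ => ?_⟩
  refine Set.mem_biUnion ⟨Ideal.Quotient.mk _ x, rfl⟩ ?_
  refine ⟨x - Quotient.out (Ideal.Quotient.mk (maximalIdeal R ^ n) x), hn ?_, by simp⟩
  refine Ideal.Quotient.eq.mp ?_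
  exact (Ideal.Quotient.mk_out _).symm

/-- Continuity of a weight at `0`. -/
theorem Weight.exists_norm_lt (w : Weight p L R) {δ : ℝ} (hδ : 0 < δ) :
    ∃ j : ℕ, ∀ r ∈ maximalIdeal R ^ j, ‖w.toRingHom r‖ < δ := by
  let := (maximalIdeal R).adicTopology
  have h : Filter.Tendsto w.toRingHom (nhds 0) (nhds 0) := by
    have := w.continuous_adic.tendsto 0
    rwa [map_zero] at this
  have h2 := h.eventually (Metric.ball_mem_nhds (0 : ℂ_[p]) hδ)
  obtain ⟨j, -, hj⟩ := (Ideal.hasBasis_nhds_zero_adic (maximalIdeal R)).mem_iff.mp h2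
  refine ⟨j, fun r hr => ?_⟩
  have := hj hr
  simpa using this

/-- Chevalley's theorem: a family of kernels of weights with trivial intersection contains a finite
subfamily whose intersection lies in a given power of the maximal ideal. -/
theorem exists_finset_iInf_ker_le [IsNoetherianRing R] [IsAdicComplete (maximalIdeal R) R]
    (h : Finite (R ⧸ maximalIdeal R)) {Ω : Set (Weight p L R)}
    (hΩ : ⨅ w ∈ Ω, RingHom.ker w.toRingHom = ⊥) (j : ℕ) :
    ∃ S : Finset Ω, ⨅ w ∈ S, RingHom.ker (w : Weight p L R).toRingHom ≤ maximalIdeal R ^ j := by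
  let := (maximalIdeal R).adicTopology
  have := compactSpace_adic h
  have hopen : IsOpen ((maximalIdeal R ^ j : Ideal R) : Set R) :=
    ((maximalIdeal R).openAddSubgroup j).isOpen
  have hcomp : IsCompact ((maximalIdeal R ^ j : Ideal R) : Set R)ᶜ := hopen.isClosed_compl.isCompact
  obtain ⟨S, hS⟩ := hcomp.elim_finite_subfamily_closed
    (fun w : Ω => ((RingHom.ker (w : Weight p L R).toRingHom : Ideal R) : Set R))
    (fun w => isClosed_singleton.preimage w.1.continuous_adic) (by
      rw [← Set.disjoint_iff_inter_eq_empty, Set.disjoint_left]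
      intro x hx hx'
      refine hx ?_
      have : x ∈ (⨅ w ∈ Ω, RingHom.ker w.toRingHom : Ideal R) := by
        simp only [Submodule.mem_iInf]
        intro w hw
        exact Set.mem_iInter.mp hx' ⟨w, hw⟩
      rw [hΩ, Ideal.mem_bot] at this
      rw [this]
      exact zero_mem _)
  refine ⟨S, fun x hx => ?_⟩
  by_contra hx'
  have : x ∈ (((maximalIdeal R ^ j : Ideal R) : Set R)ᶜ ∩
      ⋂ w ∈ S, ((RingHom.ker (w : Weight p L R).toRingHom : Ideal R) : Set R)) := by
    refine ⟨hx', ?_⟩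
    simp only [Set.mem_iInter]
    intro w hw
    simp only [Submodule.mem_iInf] at hx
    exact hx w hw
  rw [hS] at this
  exact this

end CoefficientRing

/-! ### The `𝔪`-adic filtration of the module of forms -/

section Filtration

open IsLocalRing

/-- A finitely generated module killed by an ideal of finite index is finite. -/
theorem finite_of_smul_eq_zero {R A : Type*} [CommRing R] [AddCommGroup A] [Module R A]
    [Module.Finite R A] {I : Ideal R} (hI : Finite (R ⧸ I)) (h : ∀ r ∈ I, ∀ x : A, r • x = 0) :
    Finite A := by
  obtain ⟨m, g, hg⟩ := Module.Finite.exists_fin (R := R) (M := A)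
  refine Finite.of_surjective
    (fun c : Fin m → R ⧸ I => ∑ i, (Quotient.out (c i) : R) • g i) fun a => ?_
  have ha : a ∈ Submodule.span R (Set.range g) := by rw [hg]; trivial
  obtain ⟨c, rfl⟩ := (Submodule.mem_span_range_iff_exists_fun R).mp ha
  refine ⟨fun i => Ideal.Quotient.mk I (c i), Finset.sum_congr rfl fun i _ => ?_⟩
  rw [← sub_eq_zero, ← sub_smul]
  exact h _ (Ideal.Quotient.eq.mp (Ideal.Quotient.mk_out _)) _

variable {R : Type*} [CommRing R] [IsLocalRing R]

/-- The filtration of a submodule `𝕄` of `R⟦q⟧` by the submodules `𝕄 ∩ 𝔪ʲ R⟦q⟧`. -/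
def adicFiltration (𝕄 : Submodule R R⟦X⟧) (j : ℕ) : Submodule R 𝕄 :=
  (maximalIdeal R ^ j • ⊤ : Submodule R R⟦X⟧).comap 𝕄.subtype

theorem mem_adicFiltration [IsNoetherianRing R] {𝕄 : Submodule R R⟦X⟧} {j : ℕ} {ξ : 𝕄} :
    ξ ∈ adicFiltration 𝕄 j ↔ ∀ n, PowerSeries.coeff n (ξ : R⟦X⟧) ∈ maximalIdeal R ^ j :=
  mem_smul_top_iff_coeff

/-- Completeness of `R`, uniformly in a family of sequences. -/
theorem exists_adic_limit [IsAdicComplete (maximalIdeal R) R] {ι : Type*} (u : ℕ → ι → R)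
    (h : ∀ j, ∃ n₀, ∀ n ≥ n₀, ∀ i, u n i - u n₀ i ∈ maximalIdeal R ^ j) :
    ∃ y : ι → R, ∀ j, ∃ n₀, ∀ n ≥ n₀, ∀ i, u n i - y i ∈ maximalIdeal R ^ j := by
  choose n₀ hn₀ using h
  -- the moduli of convergence are made increasing, as `IsPrecomplete` asks for the `j`-th term to
  -- be correct modulo the `j`-th power
  have hmono : Monotone (fun j => (Finset.range (j + 1)).sup n₀) := fun a b hab =>
    Finset.sup_mono (Finset.range_mono (by omega))
  set ν : ℕ → ℕ := fun j => (Finset.range (j + 1)).sup n₀ with hν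
  have hle : ∀ j, n₀ j ≤ ν j := fun j => Finset.le_sup (f := n₀) (by simp)
  have hdiff : ∀ j, ∀ a ≥ ν j, ∀ b ≥ ν j, ∀ i, u a i - u b i ∈ maximalIdeal R ^ j := by
    intro j a ha b hb i
    have := sub_mem (hn₀ j a ((hle j).trans ha) i) (hn₀ j b ((hle j).trans hb) i)
    rwa [sub_sub_sub_cancel_right] at this
  have hlim : ∀ i, ∃ y : R, ∀ j, u (ν j) i - y ∈ maximalIdeal R ^ j := by
    intro i
    obtain ⟨y, hy⟩ := IsPrecomplete.prec (I := maximalIdeal R) (M := R) inferInstance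
      (f := fun j => u (ν j) i) (by
        intro a b hab
        rw [SModEq.sub_mem, smul_eq_mul, Ideal.mul_top]
        exact hdiff a _ le_rfl _ (hmono hab) i)
    refine ⟨y, fun j => ?_⟩
    have := hy j
    rwa [SModEq.sub_mem, smul_eq_mul, Ideal.mul_top] at this
  choose y hy using hlim
  refine ⟨y, fun j => ⟨ν j, fun n hn i => ?_⟩⟩
  have := add_mem (hdiff j n hn _ le_rfl i) (hy i j)
  rwa [sub_add_sub_cancel] at this

variable {p : ℕ} [Fact p.Prime] {L : IntermediateField ℚ_[p] (PadicAlgCl p)} [Algebra (Iw p L) R]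

/-- Weights turn `𝔪`-adic convergence into convergence in `ℂ_p`, uniformly in the coefficients. -/
theorem Weight.exists_norm_coeff_map_lt (w : Weight p L R) {u : ℕ → R⟦X⟧} {ξ : R⟦X⟧}
    (h : MAdicTendsto u ξ) {δ : ℝ} (hδ : 0 < δ) :
    ∃ n₀, ∀ n ≥ n₀, ∀ i, ‖PowerSeries.coeff i
      (PowerSeries.map w.toRingHom (u n) - PowerSeries.map w.toRingHom ξ)‖ < δ := by
  obtain ⟨j, hj⟩ := w.exists_norm_lt hδ
  obtain ⟨n₀, hn₀⟩ := h j
  refine ⟨n₀, fun n hn i => ?_⟩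
  rw [← map_sub, PowerSeries.coeff_map]
  exact hj _ (coeff_mem_of_mem_smul_top (hn₀ n hn) i)

/-- An `𝔪`-adic limit of series with classical specialization at `w` has classical
specialization at `w`. -/
theorem map_mem_classicalForms_of_tendsto {ιp : AlgebraicClosure ℚ →+* PadicAlgCl p}
    {ιinf : AlgebraicClosure ℚ →+* ℂ} {κ : FormKind} {M k : ℕ} [NeZero M]
    {ψ : DirichletCharacter ℂ_[p] M} (w : Weight p L R) {u : ℕ → R⟦X⟧} {ξ : R⟦X⟧}
    (hu : ∀ n, PowerSeries.map w.toRingHom (u n) ∈ classicalForms p ιp ιinf κ M k ψ)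
    (h : MAdicTendsto u ξ) :
    PowerSeries.map w.toRingHom ξ ∈ classicalForms p ιp ιinf κ M k ψ := by
  refine mem_classicalForms_of_tendsto hu fun i => ?_
  rw [Metric.tendsto_atTop]
  intro δ hδ
  obtain ⟨n₀, hn₀⟩ := w.exists_norm_coeff_map_lt h hδ
  refine ⟨n₀, fun n hn => ?_⟩
  rw [dist_eq_norm, ← map_sub]
  exact hn₀ n hn i

/-- `𝕄 / (𝕄 ∩ 𝔪ʲ R⟦q⟧)` is finite. By Chevalley's theorem membership in `𝔪ʲ` is implied by the
vanishing at finitely many weights, and at each of them the vanishing of finitely many coefficients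
is enough. -/
theorem finite_forms_quotient [IsNoetherianRing R] [IsAdicComplete (maximalIdeal R) R]
    (hfin : Finite (R ⧸ maximalIdeal R))
    (ιp : AlgebraicClosure ℚ →+* PadicAlgCl p) (ιinf : AlgebraicClosure ℚ →+* ℂ)
    (κ : FormKind) {N t : ℕ} [NeZero (N * p ^ t)] (ht : 1 ≤ t)
    (χ : DirichletCharacter (IntRing p L) (N * p ^ t)) {Ω : Set (Weight p L R)}
    (hΩ : IsAdmissible Ω) (j : ℕ) :
    Finite (forms ιp ιinf κ ht χ Ω ⧸ adicFiltration (forms ιp ιinf κ ht χ Ω) j) := by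
  set 𝕄 := forms ιp ιinf κ ht χ Ω with h𝕄
  obtain ⟨S, hS⟩ := exists_finset_iInf_ker_le hfin hΩ.ker_inf j
  choose k hk using fun w : Ω => hΩ.classical w w.2
  choose B s hs using fun w : Ω => exists_coeff_classicalForms ιp ιinf κ (N * p ^ t) (k w)
    (nebentypus ht χ (k w))
  set J : Ideal R := ⨅ w ∈ S, RingHom.ker (w : Weight p L R).toRingHom with hJ
  let T : 𝕄 →ₗ[R] (Fin (S.sup B) → R ⧸ J) :=
    (LinearMap.pi fun i : Fin (S.sup B) =>
      (Submodule.mkQ J).comp (PowerSeries.coeff (R := R) (i : ℕ))).comp 𝕄.subtype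
  have hker : LinearMap.ker T ≤ adicFiltration 𝕄 j := by
    intro ξ hξ
    rw [mem_adicFiltration]
    intro n
    apply hS
    simp only [hJ, Submodule.mem_iInf]
    intro w hw
    have h1 : ∀ i : Fin (B w), PowerSeries.coeff (i : ℕ) (ξ : R⟦X⟧) ∈
        RingHom.ker (w : Weight p L R).toRingHom := by
      intro i
      have h2 : (Submodule.mkQ J) (PowerSeries.coeff (i : ℕ) (ξ : R⟦X⟧)) = 0 :=
        congrFun (LinearMap.mem_ker.mp hξ) ⟨i, i.2.trans_le (Finset.le_sup hw)⟩
      have h3 := (Submodule.Quotient.mk_eq_zero J).mp h2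
      simp only [hJ, Submodule.mem_iInf] at h3
      exact h3 w hw
    have h4 := hs w _ (ξ.2 w w.2 _ (hk w)) n
    rw [RingHom.mem_ker, ← PowerSeries.coeff_map, h4]
    refine Finset.sum_eq_zero fun i _ => ?_
    rw [PowerSeries.coeff_map, RingHom.mem_ker.mp (h1 i), mul_zero]
  have hfg : Module.Finite R (𝕄 ⧸ LinearMap.ker T) :=
    Module.Finite.equiv T.quotKerEquivRange.symm
  have hfg' : Module.Finite R (𝕄 ⧸ adicFiltration 𝕄 j) :=
    Module.Finite.of_surjective (Submodule.factor hker) (Submodule.factor_surjective hker)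
  refine finite_of_smul_eq_zero (R := R) (finite_quotient_maximalIdeal_pow hfin j) ?_
  intro r hr x
  obtain ⟨ξ, rfl⟩ := Submodule.Quotient.mk_surjective _ x
  rw [← Submodule.Quotient.mk_smul, Submodule.Quotient.mk_eq_zero, mem_adicFiltration]
  intro n
  rw [Submodule.coe_smul, PowerSeries.coeff_smul]
  exact Ideal.mul_mem_right _ _ hr

theorem eq_zero_of_forall_coeff_mem [IsHausdorff (maximalIdeal R) R] {ξ : R⟦X⟧}
    (h : ∀ j n, PowerSeries.coeff n ξ ∈ maximalIdeal R ^ j) : ξ = 0 := by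
  ext n
  refine IsHausdorff.haus (I := maximalIdeal R) inferInstance _ fun j => ?_
  rw [SModEq.zero, smul_eq_mul, Ideal.mul_top]
  exact h j n

theorem MAdicTendsto.unique [IsHausdorff (maximalIdeal R) R] {u : ℕ → R⟦X⟧} {ξ ζ : R⟦X⟧}
    (h : MAdicTendsto u ξ) (h' : MAdicTendsto u ζ) : ξ = ζ := by
  rw [← sub_eq_zero]
  refine eq_zero_of_forall_coeff_mem fun j n => ?_
  obtain ⟨a, ha⟩ := h j
  obtain ⟨b, hb⟩ := h' j
  have := sub_mem (hb (max a b) (le_max_right _ _)) (ha (max a b) (le_max_left _ _))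
  rw [sub_sub_sub_cancel_left] at this
  exact coeff_mem_of_mem_smul_top this n

/-- The module of forms is profinite for the `𝔪`-adic filtration. -/
theorem isProfiniteFiltration_forms [IsNoetherianRing R] [IsAdicComplete (maximalIdeal R) R]
    (hfin : Finite (R ⧸ maximalIdeal R))
    (ιp : AlgebraicClosure ℚ →+* PadicAlgCl p) (ιinf : AlgebraicClosure ℚ →+* ℂ)
    (κ : FormKind) {N t : ℕ} [NeZero (N * p ^ t)] (ht : 1 ≤ t)
    (χ : DirichletCharacter (IntRing p L) (N * p ^ t)) {Ω : Set (Weight p L R)}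
    (hΩ : IsAdmissible Ω) :
    IsProfiniteFiltration (adicFiltration (forms ιp ιinf κ ht χ Ω)) where
  finite := finite_forms_quotient hfin ιp ιinf κ ht χ hΩ
  separated := by
    intro ξ hξ
    ext1
    exact eq_zero_of_forall_coeff_mem fun j n => mem_adicFiltration.mp (hξ j) n
  complete := by
    intro u hu
    obtain ⟨y, hy⟩ := exists_adic_limit (fun n i => PowerSeries.coeff i (u n : R⟦X⟧)) (by
      intro j
      obtain ⟨n₀, hn₀⟩ := hu j
      refine ⟨n₀, fun n hn i => ?_⟩
      have := mem_adicFiltration.mp (hn₀ n hn) i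
      rwa [Submodule.coe_sub, map_sub] at this)
    have hlim : MAdicTendsto (fun n => (u n : R⟦X⟧)) (PowerSeries.mk y) := by
      intro j
      obtain ⟨n₀, hn₀⟩ := hy j
      refine ⟨n₀, fun n hn => mem_smul_top_iff_coeff.mpr fun i => ?_⟩
      rw [map_sub, PowerSeries.coeff_mk]
      exact hn₀ n hn i
    exact ⟨⟨PowerSeries.mk y, fun w hw k hk =>
      map_mem_classicalForms_of_tendsto w (fun n => (u n).2 w hw k hk) hlim⟩, hlim⟩

end Filtration

/-! ### Specialization of the Hecke coefficients -/

section Specialization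

open IsLocalRing

/-- If `p` and `y - 1` lie in `I`, then `y ^ (p ^ a)` tends to `1` for the `I`-adic topology. -/
theorem pow_prime_pow_sub_one_mem {R : Type*} [CommRing R] {I : Ideal R} {p : ℕ}
    (hp : (p : R) ∈ I) {y : R} (hy : y - 1 ∈ I) (a : ℕ) : y ^ p ^ a - 1 ∈ I ^ (a + 1) := by
  induction a with
  | zero => simpa using hy
  | succ a ih =>
    rw [pow_succ p, pow_mul, ← mul_geom_sum, pow_succ I (a + 1)]
    refine Ideal.mul_mem_mul ih ?_
    have h1 : (Ideal.Quotient.mk I) (y ^ p ^ a) = 1 := by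
      rw [← map_one (Ideal.Quotient.mk I), Ideal.Quotient.eq]
      exact Ideal.pow_le_self (by omega) ih
    rw [← Ideal.Quotient.eq_zero_iff_mem, map_sum]
    simp only [map_pow] at h1 ⊢
    simp only [h1, one_pow, Finset.sum_const, Finset.card_range, nsmul_eq_mul, mul_one]
    rw [← map_natCast (Ideal.Quotient.mk I)]
    exact Ideal.Quotient.eq_zero_iff_mem.mpr hp

variable {p : ℕ} [Fact p.Prime] {L : IntermediateField ℚ_[p] (PadicAlgCl p)}
  {R : Type*} [CommRing R] [IsLocalRing R] [Algebra (Iw p L) R]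

/-- The inclusion `ℤ_p ⊆ ℂ_p`. -/
noncomputable def padicIntToCp (p : ℕ) [Fact p.Prime] : ℤ_[p] →+* ℂ_[p] :=
  (algebraMap ℚ_[p] ℂ_[p]).comp PadicInt.Coe.ringHom

theorem norm_padicIntToCp (x : ℤ_[p]) : ‖padicIntToCp p x‖ = ‖x‖ := by
  have : ‖algebraMap ℚ_[p] ℂ_[p] (x : ℚ_[p])‖ = ‖(x : ℚ_[p])‖ := norm_algebraMap' _ _
  exact this

theorem continuous_padicIntToCp : Continuous (padicIntToCp p) :=
  AddMonoidHomClass.continuous_of_bound (padicIntToCp p) 1 fun x => by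
    rw [norm_padicIntToCp, one_mul]

theorem toCp_algebraMap (x : ℤ_[p]) :
    toCp p L (algebraMap ℤ_[p] (IntRing p L) x) = padicIntToCp p x := rfl

/-- An integral classical weight of weight `k` sends `(1 + T) ^ s` to `(1 + p) ^ (k s)`, for all
`s ∈ ℤ_p`. -/
theorem Weight.map_binomialSeries [IsLocalHom (algebraMap (Iw p L) R)] {w : Weight p L R} {k : ℕ}
    (hw : w.IsIntegralClassical k) (s : ℤ_[p]) :
    w.toRingHom (algebraMap (Iw p L) R (PowerSeries.binomialSeries (IntRing p L) s)) =
      padicIntToCp p (onePlusP p s) ^ k := by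
  set b : ℤ_[p] → ℂ_[p] := fun s =>
    w.toRingHom (algebraMap (Iw p L) R (PowerSeries.binomialSeries (IntRing p L) s)) with hb
  have hnat : ∀ n : ℕ, b n = padicIntToCp p (onePlusP p n) ^ k := by
    intro n
    simp only [hb]
    rw [PowerSeries.binomialSeries_nat, map_pow, map_pow, map_add, map_add, map_one, map_one, hw.2,
      onePlusP_natCast, map_pow, map_add, map_one, map_natCast]
    ring
  -- `s` is the limit of integers `n a` with `s - n a` divisible by `p ^ a`
  have hs : ∀ a : ℕ, ∃ u : ℤ_[p], s = (s.appr a : ℤ_[p]) + (p ^ a : ℕ) * u := by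
    intro a
    obtain ⟨u, hu⟩ := Ideal.mem_span_singleton.mp (PadicInt.appr_spec a s)
    refine ⟨u, ?_⟩
    push_cast
    rw [← hu]
    ring
  have hmul : ∀ (n : ℕ) (u : ℤ_[p]), PowerSeries.binomialSeries (IntRing p L) ((n : ℤ_[p]) * u) =
      PowerSeries.binomialSeries (IntRing p L) u ^ n := by
    intro n u
    induction n with
    | zero => simp
    | succ n ih =>
      rw [Nat.cast_succ, add_mul, one_mul, PowerSeries.binomialSeries_add, ih, pow_succ]
  have hsmall : ∀ u : ℤ_[p], algebraMap (Iw p L) R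
      (PowerSeries.binomialSeries (IntRing p L) u) - 1 ∈ maximalIdeal R := by
    intro u
    rw [← map_one (algebraMap (Iw p L) R), ← map_sub, mem_maximalIdeal, mem_nonunits_iff]
    intro h
    have h1 := (isUnit_of_map_unit (algebraMap (Iw p L) R) _ h).map
      (PowerSeries.constantCoeff (R := IntRing p L))
    rw [map_sub, PowerSeries.binomialSeries_constantCoeff, map_one, sub_self] at h1
    exact not_isUnit_zero h1
  have hnorm : ∀ n : ℕ, ‖b n‖ ≤ 1 := by
    intro n
    rw [hnat, norm_pow, norm_padicIntToCp]
    exact pow_le_one₀ (norm_nonneg _) (PadicInt.norm_le_one _)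
  have hlim : Filter.Tendsto (fun a => b (s.appr a)) Filter.atTop (nhds (b s)) := by
    rw [Metric.tendsto_atTop]
    intro δ hδ
    obtain ⟨j, hj⟩ := w.exists_norm_lt hδ
    refine ⟨j, fun a ha => ?_⟩
    obtain ⟨u, hu⟩ := hs a
    have h1 : b s = b (s.appr a) * w.toRingHom (algebraMap (Iw p L) R
        (PowerSeries.binomialSeries (IntRing p L) u) ^ p ^ a) := by
      simp only [hb]
      conv_lhs => rw [hu]
      rw [PowerSeries.binomialSeries_add, hmul, map_mul, map_mul, map_pow (algebraMap (Iw p L) R)]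
    have h2 := pow_prime_pow_sub_one_mem (natCast_mem_maximalIdeal p L R) (hsmall u) a
    have h3 := hj _ (Ideal.pow_le_pow_right (show j ≤ a + 1 by omega) h2)
    rw [dist_comm, dist_eq_norm, h1]
    calc _ = ‖b (s.appr a)‖ * ‖w.toRingHom (algebraMap (Iw p L) R
          (PowerSeries.binomialSeries (IntRing p L) u) ^ p ^ a - 1)‖ := by
          rw [← norm_mul, map_sub, map_one, mul_sub, mul_one]
      _ ≤ 1 * ‖w.toRingHom (algebraMap (Iw p L) R
          (PowerSeries.binomialSeries (IntRing p L) u) ^ p ^ a - 1)‖ := by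
          gcongr
          exact hnorm _
      _ < δ := by rwa [one_mul]
  have happr : Filter.Tendsto (fun a => (s.appr a : ℤ_[p])) Filter.atTop (nhds s) := by
    have h0 := (tendsto_p_pow p).norm
    rw [norm_zero] at h0
    rw [tendsto_iff_norm_sub_tendsto_zero]
    refine squeeze_zero (fun _ => norm_nonneg _) (fun a => ?_) h0
    obtain ⟨u, hu⟩ := Ideal.mem_span_singleton.mp (PadicInt.appr_spec a s)
    rw [norm_sub_rev, hu, norm_mul]
    exact mul_le_of_le_one_right (norm_nonneg _) (PadicInt.norm_le_one _)
  have hcont : Continuous (fun s => padicIntToCp p (onePlusP p s) ^ k) :=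
    (continuous_padicIntToCp.comp
      (PadicInt.continuous_addChar_of_value_at_one (tendsto_p_pow p))).pow k
  refine tendsto_nhds_unique hlim ?_
  simp only [hnat]
  exact (hcont.tendsto s).comp happr

theorem nebentypus_apply {N t : ℕ} (ht : 1 ≤ t) (χ : DirichletCharacter (IntRing p L) (N * p ^ t))
    (k : ℕ) {a : ℕ} (ha : a.Coprime (N * p)) :
    nebentypus ht χ k (a : ZMod (N * p ^ t)) =
      toCp p L (χ (a : ZMod (N * p ^ t))) *
        padicIntToCp p (teich p (a : ZMod p)) ^ (2 - (k : ℤ)) := by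
  have hNa : a.Coprime N := Nat.Coprime.coprime_mul_right_right ha
  have hpa : a.Coprime p := Nat.Coprime.coprime_mul_left_right ha
  have hu : IsUnit (a : ZMod (N * p ^ t)) :=
    (ZMod.isUnit_iff_coprime _ _).mpr (hNa.mul_right (hpa.pow_right t))
  have hu' : IsUnit (a : ZMod p) := (ZMod.isUnit_iff_coprime _ _).mpr hpa
  have hdvd : p ∣ N * p ^ t := dvd_mul_of_dvd_right (dvd_pow_self p (by omega)) N
  rw [nebentypus, MulChar.mul_apply, MulChar.ringHomComp_apply]
  congr 1
  have h1 := DirichletCharacter.changeLevel_eq_cast_of_dvd (teichCp p ^ (2 - (k : ℤ))) hdvd hu.unit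
  rw [IsUnit.unit_spec, ZMod.cast_natCast hdvd] at h1
  rw [h1]
  have h2 := MulChar.zpow_apply_coe (teichCp p) (2 - (k : ℤ)) hu'.unit
  rw [← MulChar.coe_toUnitHom (teichCp p), map_zpow, Units.val_zpow_eq_zpow_val,
    MulChar.coe_toUnitHom, IsUnit.unit_spec] at h2
  exact h2

/-- The specialization of `⟨ℓ⟩ χ(ℓ) ω(ℓ)² ℓ⁻¹` in weight `k` is `(χ ω^{2-k})(ℓ) ℓ^{k-1}`. -/
theorem Weight.map_heckeCoeff [IsLocalHom (algebraMap (Iw p L) R)] (hp : 3 ≤ p)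
    {w : Weight p L R} {k : ℕ} (hw : w.IsIntegralClassical k) {N t : ℕ} (ht : 1 ≤ t)
    (χ : DirichletCharacter (IntRing p L) (N * p ^ t)) {a : ℕ} (ha : a.Coprime (N * p)) :
    w.toRingHom (algebraMap (Iw p L) R (heckeCoeff χ a)) =
      nebentypus ht χ k (a : ZMod (N * p ^ t)) * (a : ℂ_[p]) ^ ((k : ℤ) - 1) := by
  have hpa : a.Coprime p := Nat.Coprime.coprime_mul_left_right ha
  have hu' : IsUnit (a : ZMod p) := (ZMod.isUnit_iff_coprime _ _).mpr hpa
  have hx : IsUnit (a : ℤ_[p]) := by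
    rw [PadicInt.isUnit_iff, PadicInt.norm_natCast_eq_one_iff]
    exact hpa.symm
  have hz : padicIntToCp p (teich p (a : ZMod p)) ≠ 0 :=
    ((hu'.map (teich p)).map (padicIntToCp p)).ne_zero
  have hinv : padicIntToCp p ((teich p)⁻¹ (a : ZMod p)) =
      (padicIntToCp p (teich p (a : ZMod p)))⁻¹ := by
    apply eq_inv_of_mul_eq_one_left
    rw [← map_mul, ← MulChar.mul_apply, inv_mul_cancel, MulChar.one_apply hu', map_one]
  have hinv' : padicIntToCp p (Ring.inverse (a : ℤ_[p])) = (a : ℂ_[p])⁻¹ := by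
    apply eq_inv_of_mul_eq_one_left
    rw [← map_natCast (padicIntToCp p), ← map_mul, Ring.inverse_mul_cancel _ hx, map_one]
  have ha0 : (a : ℂ_[p]) ≠ 0 := by
    rw [← map_natCast (padicIntToCp p)]
    exact (hx.map (padicIntToCp p)).ne_zero
  rw [heckeCoeff, angle, map_mul, map_mul, Weight.map_binomialSeries hw, w.map_const,
    onePlusP_angleExponent p hp a hpa, map_mul, map_mul, toCp_algebraMap, hinv, map_mul, map_pow,
    hinv', nebentypus_apply ht χ k ha, map_natCast, zpow_sub₀ hz, zpow_sub₀ ha0, zpow_natCast,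
    zpow_natCast, zpow_one, mul_pow, inv_pow]
  rw [show (2 : ℤ) = ((2 : ℕ) : ℤ) from rfl, zpow_natCast]
  field_simp

end Specialization

/-! ### Hecke operators on the module of forms -/

section HeckeAction

open IsLocalRing

theorem map_heckeU_pow {R S : Type*} [CommRing R] [CommRing S] (φ : R →+* S) (p n : ℕ) (ξ : R⟦X⟧) :
    PowerSeries.map φ ((heckeU p R ^ n) ξ) = (heckeU p S ^ n) (PowerSeries.map φ ξ) := by
  induction n with
  | zero => rfl
  | succ n ih =>
    rw [pow_succ', pow_succ', Module.End.mul_apply, Module.End.mul_apply, ← ih]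
    ext i
    simp [heckeU]

theorem coe_restrict_heckeU_pow {R : Type*} [CommRing R] {p : ℕ} {𝕄 : Submodule R R⟦X⟧}
    (hU : ∀ ξ ∈ 𝕄, heckeU p R ξ ∈ 𝕄) (n : ℕ) (ξ : 𝕄) :
    ((((heckeU p R).restrict hU ^ n) ξ : 𝕄) : R⟦X⟧) = (heckeU p R ^ n) (ξ : R⟦X⟧) := by
  induction n with
  | zero => rfl
  | succ n ih => rw [pow_succ', pow_succ', Module.End.mul_apply, Module.End.mul_apply,
      LinearMap.coe_restrict_apply, ih]

theorem heckeU_mem_adicFiltration {R : Type*} [CommRing R] [IsLocalRing R] [IsNoetherianRing R]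
    {p : ℕ} {𝕄 : Submodule R R⟦X⟧}
    (hU : ∀ ξ ∈ 𝕄, heckeU p R ξ ∈ 𝕄) {j : ℕ} {ξ : 𝕄} (hξ : ξ ∈ adicFiltration 𝕄 j) :
    (heckeU p R).restrict hU ξ ∈ adicFiltration 𝕄 j := by
  rw [mem_adicFiltration] at hξ ⊢
  intro n
  rw [LinearMap.coe_restrict_apply]
  simpa [heckeU] using hξ (n * p)

theorem commute_heckeU_heckeT {p : ℕ} [Fact p.Prime]
    {L : IntermediateField ℚ_[p] (PadicAlgCl p)} {R : Type*} [CommRing R] [Algebra (Iw p L) R]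
    {M : ℕ} (χ : DirichletCharacter (IntRing p L) M) {ℓ : ℕ}
    (hℓ : ℓ.Prime) (hℓp : ¬ ℓ ∣ p) : Commute (heckeU p R) (heckeT R χ ℓ) := by
  refine LinearMap.ext fun ξ => PowerSeries.ext fun n => ?_
  simp only [Module.End.mul_apply, heckeU, heckeT, LinearMap.coe_mk, AddHom.coe_mk,
    PowerSeries.coeff_mk, hℓ.dvd_mul, hℓp, or_false, mul_right_comm n p ℓ]
  split_ifs with h
  · rw [Nat.div_mul_right_comm h]
  · rfl

variable {p : ℕ} [Fact p.Prime] {L : IntermediateField ℚ_[p] (PadicAlgCl p)}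
  {R : Type*} [CommRing R] [IsLocalRing R] [Algebra (Iw p L) R]
  {ιp : AlgebraicClosure ℚ →+* PadicAlgCl p} {ιinf : AlgebraicClosure ℚ →+* ℂ}
  {κ : FormKind} {N t : ℕ} {χ : DirichletCharacter (IntRing p L) (N * p ^ t)}
  {Ω : Set (Weight p L R)}

theorem heckeU_mem_forms [NeZero (N * p ^ t)] (ht : 1 ≤ t) {ξ : R⟦X⟧}
    (hξ : ξ ∈ forms ιp ιinf κ ht χ Ω) : heckeU p R ξ ∈ forms ιp ιinf κ ht χ Ω := by
  intro w hw k hk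
  have h := map_heckeU_pow w.toRingHom p 1 ξ
  rw [pow_one, pow_one] at h
  rw [h]
  exact heckeU_mem_classicalForms (dvd_mul_of_dvd_right (dvd_pow_self p (by omega)) N)
    (hξ w hw k hk)

theorem heckeT_mem_forms [NeZero (N * p ^ t)] [IsLocalHom (algebraMap (Iw p L) R)] (hp : 3 ≤ p)
    (ht : 1 ≤ t) {ℓ : ℕ} (hℓ : ℓ.Prime) (hℓN : ¬ ℓ ∣ N * p) {ξ : R⟦X⟧}
    (hξ : ξ ∈ forms ιp ιinf κ ht χ Ω) : heckeT R χ ℓ ξ ∈ forms ιp ιinf κ ht χ Ω := by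
  intro w hw k hk
  have h : heckeT R χ ℓ ξ = heckeSeries R ℓ (algebraMap (Iw p L) R (heckeCoeff χ ℓ)) ξ := rfl
  rw [h, map_heckeSeries, Weight.map_heckeCoeff hp hk ht χ (hℓ.coprime_iff_not_dvd.mpr hℓN)]
  exact heckeSeries_mem_classicalForms hℓ (hξ w hw k hk)

theorem heckeT_mem_adicFiltration [IsNoetherianRing R] {𝕄 : Submodule R R⟦X⟧} {M : ℕ}
    {χ : DirichletCharacter (IntRing p L) M} {ℓ : ℕ}
    (hT : ∀ ξ ∈ 𝕄, heckeT R χ ℓ ξ ∈ 𝕄) {j : ℕ} {ξ : 𝕄} (hξ : ξ ∈ adicFiltration 𝕄 j) :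
    (heckeT R χ ℓ).restrict hT ξ ∈ adicFiltration 𝕄 j := by
  rw [mem_adicFiltration] at hξ ⊢
  intro n
  rw [LinearMap.coe_restrict_apply]
  simp only [heckeT, LinearMap.coe_mk, AddHom.coe_mk, PowerSeries.coeff_mk]
  refine add_mem (hξ _) ?_
  split_ifs
  · exact Ideal.mul_mem_left _ _ (hξ _)
  · exact zero_mem _

end HeckeAction

end LambdaAdic

/-! ### The ordinary projector on generalized `Λ`-adic forms -/

theorem mainTheorem7
    (p : ℕ) [Fact p.Prime] (hp : 3 ≤ p)
    (L : IntermediateField ℚ_[p] (PadicAlgCl p)) [FiniteDimensional ℚ_[p] L]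
    (ιp : AlgebraicClosure ℚ →+* PadicAlgCl p) (ιinf : AlgebraicClosure ℚ →+* ℂ)
    (R : Type*) [CommRing R] [IsDomain R] [IsLocalRing R] [IsNoetherianRing R]
    [IsAdicComplete (IsLocalRing.maximalIdeal R) R]
    [Algebra (LambdaAdic.Iw p L) R] [IsLocalHom (algebraMap (LambdaAdic.Iw p L) R)]
    [Module.Flat (LambdaAdic.Iw p L) R]
    (hres : ∀ x : R, ∃ a : LambdaAdic.IntRing p L,
      x - algebraMap (LambdaAdic.Iw p L) R (PowerSeries.C a) ∈ IsLocalRing.maximalIdeal R)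
    (N t : ℕ) (hN : 1 ≤ N) (hpN : ¬ p ∣ N) (ht : 1 ≤ t)
    (χ : DirichletCharacter (LambdaAdic.IntRing p L) (N * p ^ t))
    (Ω : Set (LambdaAdic.Weight p L R)) (hΩ : LambdaAdic.IsAdmissible Ω)
    (κ : LambdaAdic.FormKind)
    (𝕄 : Submodule R (PowerSeries R)) (h𝕄 : 𝕄 = LambdaAdic.forms ιp ιinf κ ht χ Ω) :
    -- `U_p` and the `T_ℓ` act on `𝕄`
    ∃ (hU : ∀ ξ ∈ 𝕄, LambdaAdic.heckeU p R ξ ∈ 𝕄)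
      (hT : ∀ ℓ : ℕ, ℓ.Prime → ¬ ℓ ∣ N * p → ∀ ξ ∈ 𝕄, LambdaAdic.heckeT R χ ℓ ξ ∈ 𝕄),
    ∃ e : Module.End R 𝕄,
      -- (i) `e` is a projector, the limit of the `U_p^{n!}`, and is unique
      IsIdempotentElem e ∧
      LambdaAdic.IsOrdLimit p e ∧
      (∀ e' : Module.End R 𝕄, LambdaAdic.IsOrdLimit p e' → e' = e) ∧
      -- (ii) the `U_p`-stable decomposition
      Commute e ((LambdaAdic.heckeU p R).restrict hU) ∧
      IsCompl (LinearMap.range e) (LinearMap.range (1 - e)) ∧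
      Set.BijOn ((LambdaAdic.heckeU p R).restrict hU) (LinearMap.range e : Set 𝕄)
        (LinearMap.range e : Set 𝕄) ∧
      Set.MapsTo ((LambdaAdic.heckeU p R).restrict hU) (LinearMap.range (1 - e) : Set 𝕄)
        (LinearMap.range (1 - e) : Set 𝕄) ∧
      (∀ j : ℕ, ∃ n₀ : ℕ, ∀ n ≥ n₀, ∀ ξ ∈ LinearMap.range (1 - e : Module.End R 𝕄),
        ((LambdaAdic.heckeU p R) ^ n) (ξ : PowerSeries R) ∈
          ((IsLocalRing.maximalIdeal R) ^ j • ⊤ : Submodule R (PowerSeries R))) ∧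
      -- (iii) Hecke operators away from `N p`, and specializations
      (∀ (ℓ : ℕ) (hℓ : ℓ.Prime) (hℓN : ¬ ℓ ∣ N * p),
        Commute e ((LambdaAdic.heckeT R χ ℓ).restrict (hT ℓ hℓ hℓN))) ∧
      (∀ (w : LambdaAdic.Weight p L R) (k m : ℕ) (ε : DirichletCharacter ℂ_[p] (p ^ m)),
        w.IsArithmetic k ε →
        ∀ r : ℕ, 1 ≤ r → ∀ ψ : DirichletCharacter ℂ_[p] (N * p ^ r),
        LambdaAdic.IsNebentypus N k χ ε ψ →
        ∀ (κ' : LambdaAdic.FormKind) (ξ : 𝕄),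
        PowerSeries.map w.toRingHom (ξ : PowerSeries R) ∈
          LambdaAdic.classicalForms p ιp ιinf κ' (N * p ^ r) k ψ →
        PowerSeries.map w.toRingHom (e ξ : PowerSeries R) ∈
          LambdaAdic.classicalForms p ιp ιinf κ' (N * p ^ r) k ψ ∧
        LambdaAdic.IsClassicalOrdinaryProjection p
          (PowerSeries.map w.toRingHom (ξ : PowerSeries R))
          (PowerSeries.map w.toRingHom (e ξ : PowerSeries R))) ∧
      -- (iv) change of `Ω`
      (∀ Ω' : Set (LambdaAdic.Weight p L R), LambdaAdic.IsAdmissible Ω' → Ω' ⊆ Ω →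
        ∃ hle : 𝕄 ≤ LambdaAdic.forms ιp ιinf κ ht χ Ω',
        ∀ e' : Module.End R (LambdaAdic.forms ιp ιinf κ ht χ Ω'),
          LambdaAdic.IsOrdLimit p e' →
          ∀ ξ : 𝕄, (e' (Submodule.inclusion hle ξ) : PowerSeries R) = e ξ) := by
  have : NeZero p := ⟨(Fact.out : p.Prime).ne_zero⟩
  have : NeZero N := ⟨by omega⟩
  subst h𝕄
  set 𝕄 := LambdaAdic.forms ιp ιinf κ ht χ Ω
  have hU : ∀ ξ ∈ 𝕄, LambdaAdic.heckeU p R ξ ∈ 𝕄 := fun ξ => LambdaAdic.heckeU_mem_forms ht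
  have hT : ∀ ℓ : ℕ, ℓ.Prime → ¬ ℓ ∣ N * p → ∀ ξ ∈ 𝕄, LambdaAdic.heckeT R χ ℓ ξ ∈ 𝕄 :=
    fun ℓ hℓ hℓN ξ => LambdaAdic.heckeT_mem_forms hp ht hℓ hℓN
  set U := (LambdaAdic.heckeU p R).restrict hU
  have hD : LambdaAdic.IsProfiniteFiltration (LambdaAdic.adicFiltration 𝕄) :=
    LambdaAdic.isProfiniteFiltration_forms (LambdaAdic.finite_residueField hres) ιp ιinf κ ht χ hΩ
  obtain ⟨e, V, hidem, hlim, hcomm, hUV, heV, hVU, hnil⟩ :=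
    LambdaAdic.exists_ordinary_projector (U := U) hD
      fun j ξ => LambdaAdic.heckeU_mem_adicFiltration hU
  have hlim' : LambdaAdic.IsOrdLimit p e := by
    intro ξ j
    obtain ⟨n₀, hn₀⟩ := hlim ξ j
    refine ⟨n₀, fun n hn => ?_⟩
    beta_reduce
    rw [← LambdaAdic.coe_restrict_heckeU_pow hU]
    exact hn₀ n hn
  have heU : Commute e U :=
    hcomm U (fun j ξ => LambdaAdic.heckeU_mem_adicFiltration hU) (Commute.refl U)
  have hrange : ∀ ξ ∈ LinearMap.range e, e ξ = ξ := by
    rintro _ ⟨ξ, rfl⟩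
    exact LinearMap.congr_fun hidem.eq ξ
  have heU' : ∀ ξ, e (U ξ) = U (e ξ) := fun ξ => LinearMap.congr_fun heU.eq ξ
  refine ⟨hU, hT, e, hidem, hlim', ?_, heU, ?_, ⟨?_, ?_, ?_⟩, ?_, ?_, ?_, ?_, ?_⟩
  · intro e' he'
    ext1 ξ
    exact Subtype.ext ((he' ξ).unique (hlim' ξ))
  · refine IsCompl.of_eq ?_ ?_
    · rw [Submodule.eq_bot_iff]
      rintro ξ ⟨h1, ζ, rfl⟩
      rw [← hrange _ h1, LinearMap.sub_apply, Module.End.one_apply, map_sub,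
        hrange _ ⟨ζ, rfl⟩, sub_self]
    · rw [Submodule.eq_top_iff']
      intro ξ
      exact Submodule.mem_sup.mpr ⟨e ξ, ⟨ξ, rfl⟩, ξ - e ξ, ⟨ξ, rfl⟩, add_sub_cancel _ _⟩
  -- `U_p` is bijective on the image of `e`, with inverse `V`
  · intro ξ hξ
    exact ⟨U ξ, by rw [heU', hrange ξ hξ]⟩
  · intro ξ hξ ζ hζ h
    rw [← hrange ξ hξ, ← hrange ζ hζ, ← hVU, Module.End.mul_apply, Module.End.mul_apply, h]
  · intro ξ hξ
    refine ⟨V ξ, ⟨V ξ, ?_⟩, ?_⟩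
    · conv_rhs => rw [← hrange ξ hξ]
      exact LinearMap.congr_fun heV.eq ξ
    · conv_rhs => rw [← hrange ξ hξ, ← hUV]
      rfl
  · rintro _ ⟨ξ, rfl⟩
    refine ⟨U ξ, ?_⟩
    rw [LinearMap.sub_apply, LinearMap.sub_apply, Module.End.one_apply, Module.End.one_apply,
      heU', map_sub]
  · intro j
    obtain ⟨n₀, hn₀⟩ := hnil j
    refine ⟨n₀, ?_⟩
    rintro n hn _ ⟨ξ, rfl⟩
    rw [← LambdaAdic.coe_restrict_heckeU_pow hU]
    exact hn₀ n hn ξ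
  · intro ℓ hℓ hℓN
    refine hcomm _ (fun j ξ => LambdaAdic.heckeT_mem_adicFiltration (hT ℓ hℓ hℓN)) ?_
    refine LinearMap.ext fun ξ => Subtype.ext ?_
    exact LinearMap.congr_fun (LambdaAdic.commute_heckeU_heckeT χ hℓ
      fun h => hℓN (dvd_mul_of_dvd_right h N)).eq (ξ : PowerSeries R)
  -- classical spaces are stable under `U_p` and under limits
  · intro w k m ε _ r hr ψ _ κ' ξ hξ
    refine ⟨LambdaAdic.map_mem_classicalForms_of_tendsto w (fun n => ?_) (hlim' ξ), ?_⟩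
    · rw [LambdaAdic.map_heckeU_pow]
      exact LambdaAdic.heckeU_pow_mem_classicalForms
        (dvd_mul_of_dvd_right (dvd_pow_self p (by omega)) N) _ hξ
    · intro δ hδ
      obtain ⟨n₀, hn₀⟩ := w.exists_norm_coeff_map_lt (hlim' ξ) hδ
      refine ⟨n₀, fun n hn i => ?_⟩
      rw [← LambdaAdic.map_heckeU_pow]
      exact hn₀ n hn i
  · intro Ω' _ hΩΩ'
    have hle : 𝕄 ≤ LambdaAdic.forms ιp ιinf κ ht χ Ω' := fun ξ hξ w hw => hξ w (hΩΩ' hw)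
    exact ⟨hle, fun e' he' ξ => (he' (Submodule.inclusion hle ξ)).unique (hlim' ξ)⟩
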